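/- For $a\in L^\infty(\mathbb R)$ let $a(M)$ denote the operator of multiplication by $a$ on $L^2(\mathbb R)$, and let $b(D)=F^{-1}b(M)F$, where $F$ is the unitary Fourier transform $Fu(x)=\frac1{\sqrt{2\pi}}\int_{\mathbb R}e^{-ixt}u(t)\,dt$. Let $CS(\mathbb R)$ be the set of continuous functions $\mathbb R\to\mathbb C$ that have (finite) limits at $+\infty$ and at $-\infty$, and $C_0(\mathbb R)$ the set of continuous functions $\mathbb R\to\mathbb C$ with limit $0$ at $\pm\infty$. Let - $\mathcal A\subset\mathcal L(L^2(\mathbb R))$ be the $C^*$-algebra generated by all $a(M)$ with $a\in CS(\mathbb R)$, all multiplications $e^{ijM}$ by $x\mapsto e^{ijx}$ with $j\in\mathbb Z$, and all $b(D)$ with $b\in CS(\mathbb R)$; - $\mathcal E$ be the commutator ideal of $\mathcal A$, that is, the closed two-sided ideal of $\mathcal A$ generated by all commutators $AB-BA$ with $A,B\in\mathcal A$; - $J_0\subset\mathcal L(L^2(\mathbb R))$ be the (non-unital) $C^*$-algebra generated by all products $a(M)b(D)$ with $a\in C_0(\mathbb R)$ and $b\in CS(\mathbb R)$; - $\mathcal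 K_{\mathbb R}$ be the set of compact operators on $L^2(\mathbb R)$. Then $$J_0\cap\mathcal E=\mathcal K_{\mathbb R}.$$ -/

import Mathlib

open MeasureTheory Filter Topology FourierTransform
open scoped BoundedContinuousFunction ENNReal ZeroAtInfty

noncomputable section

namespace SemiPeriodic

/-- The Hilbert space `L²(ℝ)` of complex functions, with Lebesgue measure. -/
abbrev L2R : Type := Lp ℂ 2 (volume : Measure ℝ)

/-- The C⋆-algebra of bounded operators on `L²(ℝ)`. -/
abbrev BddOp : Type := L2R →L[ℂ] L2R

/-- A bounded continuous function as an element of `L^∞(ℝ)`. -/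
def toLinfty (a : ℝ →ᵇ ℂ) : Lp ℂ ∞ (volume : Measure ℝ) :=
  (memLp_top_of_bound a.continuous.aestronglyMeasurable ‖a‖
    (ae_of_all _ a.norm_coe_le_norm)).toLp

/-- The multiplication operator `a(M)`, `(a(M)u)(x) = a(x) u(x)`. -/
def mulOp (a : ℝ →ᵇ ℂ) : BddOp :=
  (ContinuousLinearMap.mul ℂ ℂ).holderL volume ∞ 2 2 (toLinfty a)

theorem mulOp_apply_ae (a : ℝ →ᵇ ℂ) (u : L2R) :
    mulOp a u =ᵐ[volume] fun x => a x * u x := by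
  have h1 : (mulOp a u : ℝ → ℂ) =ᵐ[volume] fun x => toLinfty a x * u x :=
    (ContinuousLinearMap.mul ℂ ℂ).coeFn_holder (r := 2) (toLinfty a) u
  have h2 : (toLinfty a : ℝ → ℂ) =ᵐ[volume] a := MemLp.coeFn_toLp _
  filter_upwards [h1, h2] with x hx1 hx2
  rw [hx1, hx2]

/-- The Fourier transform on `L²(ℝ)` as a unitary operator, in the normalization
`𝓕 u (s) = ∫ e^{-2π i s y} u(y) dy`. -/
def fourierL2 : L2R ≃ₗᵢ[ℂ] L2R := Lp.fourierTransformₗᵢ ℝ ℂ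

/-- The function `s ↦ b (2π s)`. -/
def rescale (b : ℝ →ᵇ ℂ) : ℝ →ᵇ ℂ :=
  b.compContinuous ⟨fun s => 2 * Real.pi * s, by fun_prop⟩

/-- The operator `b(D) = F⁻¹ b(M) F`, where `F` is the unitary Fourier transform
`F u (t) = (2π)^{-1/2} ∫ e^{-i t y} u(y) dy`.
In terms of the transform `𝓕` with kernel `e^{-2π i s y}` one has
`F u (t) = (2π)^{-1/2} 𝓕 u (t / (2π))`, that is, `F` is `𝓕` followed by a unitary dilation, and
conjugating `b(M)` with this dilation gives multiplication by `s ↦ b (2π s)`. -/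
def diffOp (b : ℝ →ᵇ ℂ) : BddOp :=
  (fourierL2.symm : L2R →L[ℂ] L2R) ∘L mulOp (rescale b) ∘L (fourierL2 : L2R →L[ℂ] L2R)

/-- `CS(ℝ)`: continuous functions `ℝ → ℂ` having (finite) limits at `+∞` and at `-∞`.
Such a function is bounded, so nothing is lost by taking them in `ℝ →ᵇ ℂ`. -/
def CS : Set (ℝ →ᵇ ℂ) :=
  {b | (∃ l : ℂ, Tendsto b atTop (𝓝 l)) ∧ (∃ l : ℂ, Tendsto b atBot (𝓝 l))}

/-- The function `x ↦ e^{i j x}`. -/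
def expFun (j : ℤ) : ℝ →ᵇ ℂ :=
  BoundedContinuousFunction.ofNormedAddCommGroup
    (fun x : ℝ => Complex.exp (((j : ℝ) * x : ℝ) * Complex.I)) (by fun_prop) 1
    (fun x => (Complex.norm_exp_ofReal_mul_I _).le)

/-- The algebra `𝒜`: the C⋆-subalgebra of the bounded operators on `L²(ℝ)` generated by the
`a(M)` with `a ∈ CS(ℝ)`, the `e^{ijM}` with `j ∈ ℤ`, and the `b(D)` with `b ∈ CS(ℝ)`. -/
def algA : StarSubalgebra ℂ BddOp :=
  (StarAlgebra.adjoin ℂ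
    ({T | ∃ a ∈ CS, T = mulOp a} ∪ {T | ∃ j : ℤ, T = mulOp (expFun j)} ∪
      {T | ∃ b ∈ CS, T = diffOp b})).topologicalClosure

/-- The commutator ideal `ℰ` of `𝒜`, the closed two-sided ideal of `𝒜` generated by all
commutators of elements of `𝒜`, as a set of bounded operators. -/
def commIdeal : Set BddOp :=
  (fun T : algA => (T : BddOp)) ''
    closure (TwoSidedIdeal.span {T : algA | ∃ A B : algA, T = A * B - B * A} : Set algA)

/-- The algebra `J₀`: the (non-unital) C⋆-subalgebra of the bounded operators on `L²(ℝ)`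
generated by the products `a(M) b(D)` with `a ∈ C₀(ℝ)` and `b ∈ CS(ℝ)`. -/
def algJ : NonUnitalStarSubalgebra ℂ BddOp :=
  (NonUnitalStarAlgebra.adjoin ℂ
    {T | ∃ a : C₀(ℝ, ℂ), ∃ b ∈ CS, T = mulOp a.toBCF * diffOp b}).topologicalClosure

/-- The ideal `𝒦_ℝ` of compact operators on `L²(ℝ)`. -/
def compactOps : Set BddOp := {T | IsCompactOperator T}

end SemiPeriodic

end

/-! ### The functional calculi a(M) and b(D) -/

noncomputable section
namespace SemiPeriodic

/-! Elements of J₀ are controlled modulo compacts by two functions in C₀, their values at the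
frequencies ±∞. Let c be a continuous step from 0 to 1. For a ∈ C₀ the commutator of a(M) and c(D)
is compact, and so is a(M)b(D) when b ∈ C₀ as well. Hence every T in the dense ⋆-algebra generated
by the a(M)b(D) equals (f−g)(M)c(D) + g(M) plus a compact operator, with f, g ∈ C₀ (`HasSymbol`).

The pair (f, g) can be read off from T: conjugation by e^{itM} turns b(D) into b(D+t) and fixes
multiplications, so e^{−inM} T e^{inM} tends strongly to f(M) as n → +∞ and to g(M) as n → −∞. On
the ⋆-algebra generated by the generators of 𝒜 these limits exist and are multiplication operators,
so they commute. The limits therefore vanish on commutators, and then on all of ℰ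
(`hasLim_of_mem_commIdeal`). If T ∈ J₀ ∩ ℰ is the norm limit of operators tₙ with symbols (fₙ, gₙ),
then ‖fₙ(M)‖ and ‖gₙ(M)‖ are at most ‖tₙ − T‖, and T is a limit of compact operators
(`isCpt_of_mem`).

Conversely, for b concentrated near the frequency 0 the operator a(M)b(D)ā(M) is, after
normalization, nearly of rank one, so a closed subspace containing such localizations contains all
compact operators (`mem_of_isCpt`). They clearly lie in J₀. They lie in ℰ because the commutator of
e^{iM} with c(D), multiplied by e^{−iM}, is up to sign a tent function of D that is nonzero at 0
(`diffHom_cut_mem_commIdeal`). -/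

theorem ext_ae {S T : BddOp} (h : ∀ u, (S u : ℝ → ℂ) =ᵐ[volume] T u) : S = T :=
  ContinuousLinearMap.ext fun u => Lp.ext (h u)

theorem mulOp_mul (a b : ℝ →ᵇ ℂ) : mulOp (a * b) = mulOp a * mulOp b := by
  refine ext_ae fun u => ?_
  filter_upwards [mulOp_apply_ae (a * b) u, mulOp_apply_ae a (mulOp b u), mulOp_apply_ae b u]
    with x h1 h2 h3
  rw [h1, mul_apply_eq_comp, h2, h3]
  simp [mul_assoc]

theorem mulOp_add (a b : ℝ →ᵇ ℂ) : mulOp (a + b) = mulOp a + mulOp b := by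
  refine ext_ae fun u => ?_
  filter_upwards [mulOp_apply_ae (a + b) u, mulOp_apply_ae a u, mulOp_apply_ae b u,
    Lp.coeFn_add (mulOp a u) (mulOp b u)] with x h1 h2 h3 h4
  have h5 : (mulOp a + mulOp b) u = mulOp a u + mulOp b u := rfl
  rw [h1, h5, h4, Pi.add_apply, h2, h3]
  simp [add_mul]

theorem mulOp_const (r : ℂ) : mulOp (BoundedContinuousFunction.const ℝ r) = r • 1 := by
  refine ext_ae fun u => ?_
  filter_upwards [mulOp_apply_ae (BoundedContinuousFunction.const ℝ r) u, Lp.coeFn_smul r u]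
    with x h1 h2
  have h3 : (r • (1 : BddOp)) u = r • u := rfl
  rw [h1, h3, h2]
  simp

theorem mulOp_star (a : ℝ →ᵇ ℂ) : mulOp (star a) = star (mulOp a) := by
  rw [ContinuousLinearMap.star_eq_adjoint, ContinuousLinearMap.eq_adjoint_iff]
  intro u v
  rw [L2.inner_def, L2.inner_def]
  refine integral_congr_ae ?_
  filter_upwards [mulOp_apply_ae (star a) u, mulOp_apply_ae a v] with x h1 h2
  simp only [h1, h2, RCLike.inner_apply, BoundedContinuousFunction.star_apply, map_mul]
  simp
  ring

/-- The `⋆`-homomorphism `a ↦ a(M)`. -/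
def mulHom : (ℝ →ᵇ ℂ) →⋆ₐ[ℂ] BddOp where
  toFun := mulOp
  map_one' := (mulOp_const 1).trans (one_smul _ _)
  map_mul' := mulOp_mul
  map_zero' := (mulOp_const 0).trans (zero_smul _ _)
  map_add' := mulOp_add
  commutes' r := (mulOp_const r).trans (Algebra.algebraMap_eq_smul_one r).symm
  map_star' := mulOp_star

/-- The `⋆`-homomorphism `b ↦ b(2π·)`. -/
def rescaleHom : (ℝ →ᵇ ℂ) →⋆ₐ[ℂ] (ℝ →ᵇ ℂ) where
  toFun := rescale
  map_one' := rfl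
  map_mul' _ _ := rfl
  map_zero' := rfl
  map_add' _ _ := rfl
  commutes' _ := rfl
  map_star' _ := rfl

/-- Conjugation with the Fourier transform. -/
def fourierConj : BddOp →⋆ₐ[ℂ] BddOp :=
  (fourierL2.symm.conjStarAlgEquiv : BddOp →⋆ₐ[ℂ] BddOp)

theorem fourierConj_apply (T : BddOp) (u : L2R) :
    fourierConj T u = fourierL2.symm (T (fourierL2 u)) := by
  simp [fourierConj]

/-- The `⋆`-homomorphism `b ↦ b(D)`. -/
def diffHom : (ℝ →ᵇ ℂ) →⋆ₐ[ℂ] BddOp := fourierConj.comp (mulHom.comp rescaleHom)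

theorem mulHom_apply (a : ℝ →ᵇ ℂ) : mulHom a = mulOp a := rfl

theorem diffHom_apply (b : ℝ →ᵇ ℂ) : diffHom b = diffOp b := by
  ext1 u
  exact fourierConj_apply _ u

theorem norm_mulHom_le (a : ℝ →ᵇ ℂ) : ‖mulHom a‖ ≤ ‖a‖ :=
  NonUnitalStarAlgHom.norm_apply_le mulHom a

theorem norm_diffHom_le (a : ℝ →ᵇ ℂ) : ‖diffHom a‖ ≤ ‖a‖ :=
  NonUnitalStarAlgHom.norm_apply_le diffHom a

theorem continuous_mulHom : Continuous mulHom :=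
  AddMonoidHomClass.continuous_of_bound mulHom 1 fun a => by simpa using norm_mulHom_le a

theorem continuous_diffHom : Continuous diffHom :=
  AddMonoidHomClass.continuous_of_bound diffHom 1 fun a => by simpa using norm_diffHom_le a

/-- A sequence of bounded functions converging pointwise to `0` converges strongly to `0` as a
sequence of multiplication operators. -/
theorem tendsto_mulHom_zero {b : ℕ → ℝ →ᵇ ℂ} {C : ℝ} (hC : ∀ n, ‖b n‖ ≤ C)
    (hb : ∀ x, Tendsto (fun n => b n x) atTop (𝓝 0)) (u : L2R) :
    Tendsto (fun n => mulHom (b n) u) atTop (𝓝 0) := by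
  rw [tendsto_zero_iff_norm_tendsto_zero]
  have hsq : ∀ n, ‖mulHom (b n) u‖ ^ 2 = ∫ x, ‖b n x * u x‖ ^ 2 := by
    intro n
    rw [← inner_self_eq_norm_sq (𝕜 := ℂ), L2.inner_def]
    rw [← integral_re (L2.integrable_inner _ _)]
    refine integral_congr_ae ?_
    filter_upwards [mulOp_apply_ae (b n) u] with x hx
    rw [mulHom_apply, hx, inner_self_eq_norm_sq]
  have hlim : Tendsto (fun n => ∫ x, ‖b n x * u x‖ ^ 2) atTop (𝓝 (∫ _ : ℝ, (0 : ℝ))) := by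
    refine tendsto_integral_of_dominated_convergence (fun x => C ^ 2 * ‖u x‖ ^ 2) ?_ ?_ ?_ ?_
    · intro n
      exact (((b n).continuous.aestronglyMeasurable.mul (Lp.aestronglyMeasurable u)).norm).pow 2
    · exact ((Lp.memLp u).integrable_norm_pow (by norm_num)).const_mul _
    · refine fun n => ae_of_all _ fun x => ?_
      rw [norm_mul, mul_pow, Real.norm_of_nonneg (by positivity)]
      gcongr
      exact ((b n).norm_coe_le_norm x).trans (hC n)
    · refine ae_of_all _ fun x => ?_
      simpa using (((hb x).mul_const (u x)).norm).pow 2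
  have h0 : Tendsto (fun n => Real.sqrt (‖mulHom (b n) u‖ ^ 2)) atTop (𝓝 (Real.sqrt 0)) := by
    simp_rw [hsq]
    have := (Real.continuous_sqrt.tendsto _).comp hlim
    rw [integral_zero] at this
    exact this
  simpa [Real.sqrt_sq] using h0

theorem tendsto_diffHom_zero {b : ℕ → ℝ →ᵇ ℂ} {C : ℝ} (hC : ∀ n, ‖b n‖ ≤ C)
    (hb : ∀ x, Tendsto (fun n => b n x) atTop (𝓝 0)) (u : L2R) :
    Tendsto (fun n => diffHom (b n) u) atTop (𝓝 0) := by
  have h := tendsto_mulHom_zero (b := fun n => rescale (b n)) (C := C) (fun n => ?_)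
    (fun x => hb _) (fourierL2 u)
  · have := ((fourierL2.symm.continuous.tendsto _).comp h)
    rw [map_zero] at this
    refine this.congr fun n => ?_
    exact (fourierConj_apply _ _).symm
  · exact ((rescale (b n)).norm_le ((norm_nonneg _).trans (hC n))).2
      fun x => ((b n).norm_coe_le_norm _).trans (hC n)

end SemiPeriodic
end

/-! ### The inverse Fourier integral, modulations and translations -/

noncomputable section
namespace SemiPeriodic

/-- Fubini's multiplication formula. It identifies the inverse transform on L², known through its
action on test functions, with the integral. -/
theorem integrable_mul_fourierInv {f : ℝ → ℂ} (hf : Integrable f) (g : SchwartzMap ℝ ℂ) :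
    ∫ x, (𝓕⁻ g) x • f x = ∫ x, g x • (𝓕⁻ f) x := by
  have h := VectorFourier.integral_bilin_fourierIntegral_eq_flip
    (ContinuousLinearMap.lsmul ℂ ℂ (E := ℂ)) (L := -innerₗ ℝ) (μ := volume) (ν := volume)
    (e := Real.fourierChar) (f := g) (g := f)
    Real.continuous_fourierChar continuous_inner.neg g.integrable hf
  have hflip : (-innerₗ ℝ : ℝ →ₗ[ℝ] ℝ →ₗ[ℝ] ℝ).flip = -innerₗ ℝ := by
    ext; simp
  rw [hflip] at h
  simpa [SchwartzMap.fourierInv_coe] using! h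

theorem continuous_fourierInv_of_integrable {f : ℝ → ℂ} (hf : Integrable f) :
    Continuous (𝓕⁻ f) :=
  VectorFourier.fourierIntegral_continuous (L := -innerₗ ℝ) Real.continuous_fourierChar
    continuous_inner.neg hf

/-- On `L¹ ∩ L²` the inverse Fourier transform is given by the integral. -/
theorem fourierL2_symm_ae_eq (f : L2R) (hf : Integrable f) :
    (fourierL2.symm f : ℝ → ℂ) =ᵐ[volume] 𝓕⁻ (f : ℝ → ℂ) := by
  refine ae_eq_of_integral_contDiff_smul_eq
    ((Lp.memLp (fourierL2.symm f)).locallyIntegrable one_le_two)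
    (continuous_fourierInv_of_integrable hf).locallyIntegrable fun g hg hgc => ?_
  have hg₁ : HasCompactSupport (Complex.ofRealCLM ∘ g) := hgc.comp_left rfl
  have hg₂ : ContDiff ℝ ((⊤ : ℕ∞) : WithTop ℕ∞) (Complex.ofRealCLM ∘ g) :=
    Complex.ofRealCLM.contDiff.comp hg
  set G : SchwartzMap ℝ ℂ := hg₁.toSchwartzMap hg₂
  have h1 := congrArg (fun T => T G) (Lp.fourierInv_toTemperedDistribution_eq f)
  simp only [TemperedDistribution.fourierInv_apply, Lp.toTemperedDistribution_apply] at h1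
  rw [integrable_mul_fourierInv hf] at h1
  exact h1.symm

theorem fourierInv_eq_integral (f : ℝ → ℂ) (x : ℝ) :
    (𝓕⁻ f) x = ∫ ξ, Complex.exp ((2 * Real.pi * (ξ * x) : ℝ) * Complex.I) * f ξ := by
  simp [Real.fourierInv_eq', mul_comm]

/-- The function `x ↦ e^{itx}`. -/
def expR (t : ℝ) : ℝ →ᵇ ℂ :=
  BoundedContinuousFunction.ofNormedAddCommGroup
    (fun x : ℝ => Complex.exp ((t * x : ℝ) * Complex.I)) (by fun_prop) 1
    (fun x => (Complex.norm_exp_ofReal_mul_I _).le)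

theorem expR_apply (t x : ℝ) : expR t x = Complex.exp ((t * x : ℝ) * Complex.I) := rfl

theorem expFun_eq (j : ℤ) : expFun j = expR j := rfl

theorem expR_add (s t : ℝ) : expR (s + t) = expR s * expR t := by
  ext x
  simp [expR_apply, ← Complex.exp_add, add_mul]

theorem expR_zero : expR 0 = 1 := by
  ext x
  simp [expR_apply]

/-- The translate `x ↦ b (x - t)`. -/
def shift (t : ℝ) (b : ℝ →ᵇ ℂ) : ℝ →ᵇ ℂ := b.compContinuous ⟨fun x => x - t, by fun_prop⟩

theorem shift_apply (t : ℝ) (b : ℝ →ᵇ ℂ) (x : ℝ) : shift t b x = b (x - t) := rfl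

/-- Translation by `s` on `L²(ℝ)`. -/
def translate (s : ℝ) : L2R →L[ℂ] L2R :=
  (Lp.compMeasurePreservingₗᵢ ℂ (fun x : ℝ => x - s)
    (measurePreserving_sub_right volume s)).toContinuousLinearMap

theorem translate_ae (s : ℝ) (u : L2R) :
    (translate s u : ℝ → ℂ) =ᵐ[volume] fun x => u (x - s) :=
  Lp.coeFn_compMeasurePreserving u (measurePreserving_sub_right volume s)

/-- A change of variable in the integral for Schwartz functions; both sides are continuous in `u`
and Schwartz functions are dense. -/
theorem fourierL2_symm_translate (s : ℝ) (u : L2R) :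
    fourierL2.symm (translate s u) = mulHom (expR (2 * Real.pi * s)) (fourierL2.symm u) := by
  refine (SchwartzMap.denseRange_toLpCLM (F := ℂ) (E := ℝ) (p := 2) (μ := volume)
    ENNReal.ofNat_ne_top).induction_on
    (p := fun u => fourierL2.symm (translate s u) =
      mulHom (expR (2 * Real.pi * s)) (fourierL2.symm u)) u ?_ ?_
  · exact isClosed_eq (fourierL2.symm.continuous.comp (translate s).continuous)
      ((mulHom _).continuous.comp fourierL2.symm.continuous)
  · intro g
    set v : L2R := SchwartzMap.toLpCLM ℝ ℂ 2 volume g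
    have hv : (v : ℝ → ℂ) =ᵐ[volume] g := g.coeFn_toLp 2 volume
    have hvi : Integrable v := g.integrable.congr hv.symm
    have hti : Integrable (translate s v) :=
      (hvi.comp_sub_right s).congr (translate_ae s v).symm
    refine Lp.ext ?_
    filter_upwards [fourierL2_symm_ae_eq _ hti, fourierL2_symm_ae_eq _ hvi,
      mulOp_apply_ae (expR (2 * Real.pi * s)) (fourierL2.symm v)] with x h1 h2 h3
    rw [mulHom_apply, h1, h3, h2, Real.fourierInv_congr_ae (translate_ae s v),
      fourierInv_eq_integral, fourierInv_eq_integral, expR_apply, ← integral_const_mul,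
      ← integral_add_right_eq_self _ s]
    refine integral_congr_ae (ae_of_all _ fun ξ => ?_)
    simp only [add_sub_cancel_right]
    rw [← mul_assoc (Complex.exp _), ← Complex.exp_add]
    congr 2
    push_cast
    ring

theorem translate_mulOp (s : ℝ) (β : ℝ →ᵇ ℂ) (u : L2R) :
    translate s (mulOp β u) = mulOp (shift s β) (translate s u) := by
  refine Lp.ext ?_
  have h := (measurePreserving_sub_right volume s).quasiMeasurePreserving.ae (mulOp_apply_ae β u)
  filter_upwards [translate_ae s (mulOp β u), mulOp_apply_ae (shift s β) (translate s u),
    translate_ae s u, h] with x h1 h2 h3 h4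
  rw [h1, h2, h3, h4, shift_apply]

/-- Commuting a modulation past `b(D)` translates `b`. -/
theorem mulHom_expR_mul_diffHom (t : ℝ) (b : ℝ →ᵇ ℂ) :
    mulHom (expR t) * diffHom b = diffHom (shift t b) * mulHom (expR t) := by
  -- The factor 2π converts between the frequency variable of `diffHom` and that of `fourierL2`.
  have ht : t = 2 * Real.pi * (t / (2 * Real.pi)) := by field_simp
  set s := t / (2 * Real.pi)
  have hshift : shift s (rescale b) = rescale (shift t b) := by
    ext x
    change b (2 * Real.pi * (x - s)) = b (2 * Real.pi * x - t)
    rw [mul_sub, ← ht]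
  ext1 u
  have h1 : fourierL2 (mulHom (expR t) u) = translate s (fourierL2 u) := by
    have := fourierL2_symm_translate s (fourierL2 u)
    rw [← ht, LinearIsometryEquiv.symm_apply_apply] at this
    rw [← this, LinearIsometryEquiv.apply_symm_apply]
  have h2 : ∀ (c : ℝ →ᵇ ℂ) v, diffHom c v = fourierL2.symm (mulOp (rescale c) (fourierL2 v)) :=
    fun c v => fourierConj_apply _ v
  rw [mul_apply_eq_comp, mul_apply_eq_comp, h2, h2, h1, ht, ← fourierL2_symm_translate, ← ht,
    translate_mulOp, hshift]

end SemiPeriodic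
end

/-! ### Finite-rank approximation of a(M)b(D) -/

noncomputable section
namespace SemiPeriodic

theorem integrable_mul_L2 (u v : L2R) : Integrable fun x => u x * v x :=
  (Lp.memLp u).integrable_mul (Lp.memLp v)

theorem integral_norm_mul_le (u v : L2R) : ∫ x, ‖u x‖ * ‖v x‖ ≤ ‖u‖ * ‖v‖ := by
  have hu := (Lp.memLp u).norm
  have hv := (Lp.memLp v).norm
  have h := real_inner_le_norm (hu.toLp _) (hv.toLp _)
  rw [Lp.norm_toLp, Lp.norm_toLp, eLpNorm_norm, eLpNorm_norm, L2.inner_def] at h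
  refine le_trans (le_of_eq (integral_congr_ae ?_)) h
  filter_upwards [hu.coeFn_toLp, hv.coeFn_toLp] with x h1 h2
  rw [h1, h2]
  simp [mul_comm]

open Classical in
/-- The class in `L²(ℝ)` of a square integrable function (`0` for other functions). -/
def toL2 (f : ℝ → ℂ) : L2R := if h : MemLp f 2 volume then h.toLp f else 0

theorem toL2_ae {f : ℝ → ℂ} (h : MemLp f 2 volume) : (toL2 f : ℝ → ℂ) =ᵐ[volume] f := by
  rw [toL2, dif_pos h]
  exact h.coeFn_toLp

theorem toL2_eq {f : ℝ → ℂ} (h : MemLp f 2 volume) {u : L2R} (hu : (u : ℝ → ℂ) =ᵐ[volume] f) :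
    u = toL2 f :=
  Lp.ext (hu.trans (toL2_ae h).symm)

theorem memLp_of_compact {f : ℝ → ℂ} (hf : Continuous f) (h : HasCompactSupport f) :
    MemLp f 2 volume :=
  hf.memLp_of_hasCompactSupport h

theorem inner_toL2_conj {f : ℝ → ℂ} (h : MemLp f 2 volume) (u : L2R) :
    inner ℂ (toL2 fun x => star (f x)) u = ∫ x, f x * u x := by
  rw [L2.inner_def]
  refine integral_congr_ae ?_
  filter_upwards [toL2_ae (f := fun x => star (f x)) h.star] with x hx
  rw [hx]
  simp [mul_comm]

open InnerProductSpace in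
/-- If the kernel `e^{2πixξ}` is approximated by `∑ f_k(x) g_k(ξ)` on the supports of `a` and
`b(2π·)`, then `a(M)b(D)` is approximated by an operator of finite rank. -/
theorem norm_mulHom_mul_diffHom_sub_le {ι : Type*} (s : Finset ι) (a b : ℝ →ᵇ ℂ)
    (ha : HasCompactSupport a) (hb : HasCompactSupport (rescale b)) (f g : ι → ℝ → ℂ)
    (hf : ∀ k, Continuous (f k)) (hg : ∀ k, Continuous (g k)) {ε : ℝ} (hε0 : 0 ≤ ε)
    (hε : ∀ x ξ, a x ≠ 0 → rescale b ξ ≠ 0 →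
      ‖Complex.exp ((2 * Real.pi * (ξ * x) : ℝ) * Complex.I) - ∑ k ∈ s, f k x * g k ξ‖ ≤ ε) :
    ‖mulHom a * diffHom b - ∑ k ∈ s, rankOne ℂ (toL2 fun x => a x * f k x)
      (fourierL2.symm (toL2 fun ξ => star (rescale b ξ * g k ξ)))‖ ≤
      ε * ‖toL2 a‖ * ‖toL2 (rescale b)‖ := by
  have hLa : MemLp a 2 volume := memLp_of_compact a.continuous ha
  have hLb : MemLp (rescale b) 2 volume := memLp_of_compact (rescale b).continuous hb
  have hLf : ∀ k, MemLp (fun x => a x * f k x) 2 volume := fun k =>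
    memLp_of_compact (a.continuous.mul (hf k)) ha.mul_right
  have hLg : ∀ k, MemLp (fun ξ => rescale b ξ * g k ξ) 2 volume := fun k =>
    memLp_of_compact ((rescale b).continuous.mul (hg k)) hb.mul_right
  refine ContinuousLinearMap.opNorm_le_bound _ (by positivity) fun u => ?_
  set w := fourierL2 u
  have hu : ‖u‖ = ‖w‖ := (fourierL2.norm_map u).symm
  have hβw : Integrable (mulOp (rescale b) w) := by
    refine (integrable_mul_L2 (toL2 (rescale b)) w).congr ?_
    filter_upwards [toL2_ae hLb, mulOp_apply_ae (rescale b) w] with x h1 h2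
    rw [h1, h2]
  have happ : (mulHom a * diffHom b - ∑ k ∈ s, rankOne ℂ (toL2 fun x => a x * f k x)
      (fourierL2.symm (toL2 fun ξ => star (rescale b ξ * g k ξ)))) u =
      mulOp a (fourierL2.symm (mulOp (rescale b) w)) - ∑ k ∈ s,
        (∫ ξ, rescale b ξ * g k ξ * w ξ) • toL2 fun x => a x * f k x := by
    rw [sub_apply, sum_apply]
    refine congrArg₂ _ (congrArg (mulOp a) (fourierConj_apply _ u))
      (Finset.sum_congr rfl fun k _ => ?_)
    rw [rankOne_apply, ← inner_toL2_conj (hLg k)]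
    congr 1
    rw [← LinearIsometryEquiv.inner_map_map fourierL2,
      LinearIsometryEquiv.apply_symm_apply]
  rw [happ, hu]
  have hint : ∀ k, Integrable fun ξ => rescale b ξ * g k ξ * w ξ := fun k => by
    refine (integrable_mul_L2 (toL2 fun ξ => rescale b ξ * g k ξ) w).congr ?_
    filter_upwards [toL2_ae (hLg k)] with x h1
    rw [h1]
  have hsum : ∀ᵐ x, (↑(∑ k ∈ s, (∫ ξ, rescale b ξ * g k ξ * w ξ) • toL2 fun x => a x * f k x) :
      ℝ → ℂ) x = ∑ k ∈ s, (∫ ξ, rescale b ξ * g k ξ * w ξ) * (a x * f k x) := by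
    have h1 : ∀ k ∈ s, ∀ᵐ x, ((∫ ξ, rescale b ξ * g k ξ * w ξ) • toL2 fun x => a x * f k x :
        L2R) x = (∫ ξ, rescale b ξ * g k ξ * w ξ) * (a x * f k x) := fun k _ => by
      filter_upwards [Lp.coeFn_smul (∫ ξ, rescale b ξ * g k ξ * w ξ)
        (toL2 fun x => a x * f k x), toL2_ae (hLf k)] with x h2 h3
      rw [h2, Pi.smul_apply, h3, smul_eq_mul]
    filter_upwards [Lp.coeFn_finsetSum s fun k =>
      (∫ ξ, rescale b ξ * g k ξ * w ξ) • toL2 fun x => a x * f k x,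
      (Finset.eventually_all s).2 h1] with x h2 h3
    rw [h2, Finset.sum_apply]
    exact Finset.sum_congr rfl h3
  have hCS : ∫ ξ, ‖rescale b ξ‖ * ‖w ξ‖ ≤ ‖toL2 (rescale b)‖ * ‖w‖ := by
    refine le_trans (le_of_eq (integral_congr_ae ?_)) (integral_norm_mul_le _ w)
    filter_upwards [toL2_ae hLb] with x h1
    rw [h1]
  have hCSi : Integrable fun ξ => ‖rescale b ξ‖ * ‖w ξ‖ := by
    refine (integrable_mul_L2 (toL2 (rescale b)) w).norm.congr ?_
    filter_upwards [toL2_ae hLb] with x h1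
    rw [h1, norm_mul]
  -- It suffices to bound the function pointwise by a constant times |a(x)|; the constant comes from
  -- Cauchy–Schwarz in ξ.
  refine (Lp.norm_le_mul_norm_of_ae_le_mul (g := toL2 a)
    (c := ε * (‖toL2 (rescale b)‖ * ‖w‖)) ?_).trans (le_of_eq (by ring))
  filter_upwards [Lp.coeFn_sub (mulOp a (fourierL2.symm (mulOp (rescale b) w)))
    (∑ k ∈ s, (∫ ξ, rescale b ξ * g k ξ * w ξ) • toL2 fun x => a x * f k x),
    hsum, mulOp_apply_ae a (fourierL2.symm (mulOp (rescale b) w)),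
    fourierL2_symm_ae_eq _ hβw, toL2_ae hLa] with x h1 h2 h3 h4 h5
  rw [h1, Pi.sub_apply, h2, h3, h4, h5, Real.fourierInv_congr_ae (mulOp_apply_ae (rescale b) w),
    fourierInv_eq_integral]
  -- The kernel estimate is available only where a(x) ≠ 0; elsewhere both sides vanish.
  by_cases hax : a x = 0
  · simp [hax]
  have hexp : Integrable fun ξ =>
      Complex.exp ((2 * Real.pi * (ξ * x) : ℝ) * Complex.I) * (rescale b ξ * w ξ) := by
    refine (hβw.congr (mulOp_apply_ae (rescale b) w)).bdd_mul (c := 1) ?_ ?_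
    · exact (by fun_prop : Continuous fun ξ : ℝ =>
        Complex.exp ((2 * Real.pi * (ξ * x) : ℝ) * Complex.I)).aestronglyMeasurable
    · exact ae_of_all _ fun ξ => (Complex.norm_exp_ofReal_mul_I _).le
  have hrw : a x * (∫ ξ, Complex.exp ((2 * Real.pi * (ξ * x) : ℝ) * Complex.I) *
      (rescale b ξ * w ξ)) - ∑ k ∈ s, (∫ ξ, rescale b ξ * g k ξ * w ξ) * (a x * f k x) =
      a x * ∫ ξ, (Complex.exp ((2 * Real.pi * (ξ * x) : ℝ) * Complex.I) -
        ∑ k ∈ s, f k x * g k ξ) * (rescale b ξ * w ξ) := by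
    have : ∀ ξ, (Complex.exp ((2 * Real.pi * (ξ * x) : ℝ) * Complex.I) -
        ∑ k ∈ s, f k x * g k ξ) * (rescale b ξ * w ξ) =
        Complex.exp ((2 * Real.pi * (ξ * x) : ℝ) * Complex.I) * (rescale b ξ * w ξ) -
        ∑ k ∈ s, f k x * (rescale b ξ * g k ξ * w ξ) := fun ξ => by
      rw [sub_mul, Finset.sum_mul]
      congr 1
      exact Finset.sum_congr rfl fun k _ => by ring
    simp_rw [this]
    rw [integral_sub hexp (integrable_finsetSum _ fun k _ => (hint k).const_mul _),
      integral_finsetSum _ fun k _ => (hint k).const_mul _, mul_sub, Finset.mul_sum]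
    congr 1
    refine Finset.sum_congr rfl fun k _ => ?_
    rw [integral_const_mul]
    ring
  rw [hrw, norm_mul, mul_comm]
  gcongr
  refine (norm_integral_le_of_norm_le (hCSi.const_mul ε) (ae_of_all _ fun ξ => ?_)).trans ?_
  · rw [norm_mul, norm_mul]
    by_cases hbξ : rescale b ξ = 0
    · simp [hbξ]
    · gcongr
      exact hε x ξ hax hbξ
  · rw [integral_const_mul]
    gcongr

end SemiPeriodic
end

noncomputable section
namespace SemiPeriodic

/-! ### Compact operators on a Hilbert space -/

/-- Compactness of an operator on `L²(ℝ)`. -/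
def IsCpt (T : BddOp) : Prop := IsCompactOperator (T : L2R → L2R)

theorem isClosed_compactOps : IsClosed {T : BddOp | IsCpt T} :=
  isClosed_setOfPred_isCompactOperator

theorem isCompactOperator_rankOne (u v : L2R) :
    IsCpt (InnerProductSpace.rankOne ℂ u v) := by
  have h : IsCompactOperator (innerSL ℂ v) :=
    (isCompactOperator_id (E := ℂ)).comp_clm (innerSL ℂ v)
  exact h.clm_comp (ContinuousLinearMap.toSpanSingleton ℂ u)

/-- A closed subspace containing the operators of rank one contains the compact operators. -/
theorem mem_of_isCompactOperator {X : Submodule ℂ BddOp} (hX : IsClosed (X : Set BddOp))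
    (h : ∀ u v : L2R, InnerProductSpace.rankOne ℂ u v ∈ X) {T : BddOp}
    (hT : IsCpt T) : T ∈ X := by
  refine hX.closure_subset (Metric.mem_closure_iff.2 fun ε hε => ?_)
  obtain ⟨K, hK, hKT⟩ := hT.image_closedBall_subset_compact (f := (T : L2R →ₗ[ℂ] L2R)) 1
  obtain ⟨t, htf, htK⟩ :=
    Metric.totallyBounded_iff.1 hK.totallyBounded _ (half_pos hε)
  -- The span of a finite ε/2-net of the image of the unit ball: projecting onto it moves T by at
  -- most ε/2, and the projected operator is a finite sum of rank-one operators.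
  set S : Submodule ℂ L2R := Submodule.span ℂ t
  have : FiniteDimensional ℂ S := FiniteDimensional.span_of_finite ℂ htf
  let e := stdOrthonormalBasis ℂ S
  refine ⟨S.starProjection * T, ?_, ?_⟩
  · rw [e.starProjection_eq_sum_rankOne, Finset.sum_mul]
    refine X.sum_mem fun i _ => ?_
    rw [ContinuousLinearMap.mul_def, InnerProductSpace.rankOne_comp]
    exact h _ _
  · rw [dist_eq_norm]
    refine lt_of_le_of_lt ?_ (half_lt_self hε)
    refine ContinuousLinearMap.opNorm_le_of_unit_norm (half_pos hε).le fun u hu => ?_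
    have hTu : T u ∈ K := hKT ⟨u, by simp [hu], rfl⟩
    obtain ⟨y, hy, hyd⟩ := Set.mem_iUnion₂.1 (htK hTu)
    rw [sub_apply, mul_apply_eq_comp, Submodule.starProjection_minimal]
    refine (ciInf_le ⟨0, ?_⟩ (⟨y, Submodule.subset_span hy⟩ : S)).trans ?_
    · rintro _ ⟨z, rfl⟩
      positivity
    · rw [← dist_eq_norm]
      exact (le_of_lt hyd)

/-- Operators with compact adjoint form a closed subspace containing the rank-one operators, hence
all compact ones. -/
theorem isCompactOperator_star {T : BddOp} (hT : IsCpt T) :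
    IsCpt (star T) := by
  let X : Submodule ℂ BddOp :=
    { carrier := {T | IsCpt (star T)}
      add_mem' := fun {S T} hS hT => by
        change IsCpt (star (S + T) : BddOp)
        rw [star_add]
        exact IsCompactOperator.add hS hT
      zero_mem' := by
        change IsCpt (star 0 : BddOp)
        rw [star_zero]
        exact isCompactOperator_zero
      smul_mem' := fun c T hT => by
        change IsCpt (star (c • T) : BddOp)
        rw [star_smul]
        exact (compactOperator (RingHom.id ℂ) L2R L2R).smul_mem _ hT }
  have hX : IsClosed (X : Set BddOp) := isClosed_compactOps.preimage continuous_star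
  refine mem_of_isCompactOperator hX (fun u v => ?_) hT
  change IsCpt (star (InnerProductSpace.rankOne ℂ u v))
  rw [ContinuousLinearMap.star_eq_adjoint, InnerProductSpace.adjoint_rankOne]
  exact isCompactOperator_rankOne v u

theorem isCompactOperator_mul_left {T : BddOp} (hT : IsCpt T) (S : BddOp) :
    IsCpt (S * T) := hT.clm_comp S

theorem isCompactOperator_mul_right {T : BddOp} (hT : IsCpt T) (S : BddOp) :
    IsCpt (T * S) := hT.comp_clm S

/-! ### Functions vanishing at infinity -/

/-- The cut-off function `x ↦ min 1 (R - |x|)⁺`. -/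
def cut (R : ℝ) : ℝ →ᵇ ℂ :=
  BoundedContinuousFunction.ofNormedAddCommGroup
    (fun x : ℝ => ((max 0 (min 1 (R - |x|)) : ℝ) : ℂ)) (by fun_prop) 1 (fun x => by
      rw [Complex.norm_real, Real.norm_of_nonneg (le_max_left _ _)]
      exact max_le zero_le_one (min_le_left _ _))

theorem cut_apply (R x : ℝ) : cut R x = ((max 0 (min 1 (R - |x|)) : ℝ) : ℂ) := rfl

theorem cut_eq_zero {R x : ℝ} (h : R ≤ |x|) : cut R x = 0 := by
  rw [cut_apply, max_eq_left (min_le_of_right_le (by linarith)), Complex.ofReal_zero]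

theorem cut_eq_one {R x : ℝ} (h : |x| ≤ R - 1) : cut R x = 1 := by
  rw [cut_apply, min_eq_left (by linarith), max_eq_right zero_le_one, Complex.ofReal_one]

theorem star_cut (R : ℝ) : star (cut R) = cut R := by
  ext x
  rw [BoundedContinuousFunction.star_apply, cut_apply]
  exact Complex.conj_ofReal _

theorem norm_one_sub_cut_le (R x : ℝ) : ‖1 - cut R x‖ ≤ 1 := by
  rw [cut_apply, ← Complex.ofReal_one, ← Complex.ofReal_sub, Complex.norm_real,
    Real.norm_of_nonneg (sub_nonneg.2 (max_le zero_le_one (min_le_left _ _)))]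
  have := le_max_left 0 (min 1 (R - |x|))
  linarith

theorem hasCompactSupport_of_abs {b : ℝ →ᵇ ℂ} {R : ℝ} (h : ∀ x, R < |x| → b x = 0) :
    HasCompactSupport b :=
  HasCompactSupport.intro (isCompact_closedBall (0 : ℝ) R) fun x hx =>
    h x (by simpa using hx)

theorem hasCompactSupport_cut (R : ℝ) : HasCompactSupport (cut R) :=
  hasCompactSupport_of_abs fun _ h => cut_eq_zero h.le

theorem exists_abs_le_of_hasCompactSupport {b : ℝ →ᵇ ℂ} (hb : HasCompactSupport b) :
    ∃ R > 0, ∀ x, b x ≠ 0 → |x| ≤ R := by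
  obtain ⟨R, hR⟩ := hb.isCompact.isBounded.subset_closedBall (0 : ℝ)
  refine ⟨max R 1, by positivity, fun x hx => ?_⟩
  have := hR (subset_tsupport _ hx)
  rw [mem_closedBall_zero_iff, Real.norm_eq_abs] at this
  exact this.trans (le_max_left _ _)

theorem rescale_apply (b : ℝ →ᵇ ℂ) (ξ : ℝ) : rescale b ξ = b (2 * Real.pi * ξ) := rfl

theorem hasCompactSupport_rescale {b : ℝ →ᵇ ℂ} (hb : HasCompactSupport b) :
    HasCompactSupport (rescale b) := by
  obtain ⟨R, -, hR⟩ := exists_abs_le_of_hasCompactSupport hb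
  refine hasCompactSupport_of_abs (R := R) fun x hx => ?_
  by_contra hne
  have h1 := hR _ hne
  change |2 * Real.pi * x| ≤ R at h1
  rw [abs_mul, abs_of_pos Real.two_pi_pos] at h1
  nlinarith [Real.pi_gt_three, abs_nonneg x]

/-- Bounded continuous functions vanishing at infinity. -/
def IsC0 (b : ℝ →ᵇ ℂ) : Prop := Tendsto b (cocompact ℝ) (𝓝 0)

theorem IsC0.mul_right {a : ℝ →ᵇ ℂ} (ha : IsC0 a) (b : ℝ →ᵇ ℂ) : IsC0 (a * b) :=
  ha.zero_mul_isBoundedUnder_le ⟨‖b‖, eventually_map.2 (.of_forall b.norm_coe_le_norm)⟩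

theorem IsC0.star {a : ℝ →ᵇ ℂ} (ha : IsC0 a) : IsC0 (star a) := by
  have := (continuous_star.tendsto (0 : ℂ)).comp ha
  rwa [star_zero] at this

theorem IsC0.tendsto_mul_cut {a : ℝ →ᵇ ℂ} (ha : IsC0 a) :
    Tendsto (fun n : ℕ => a * cut n) atTop (𝓝 a) := by
  rw [Metric.tendsto_atTop]
  intro ε hε
  have h : ∀ᶠ x in cocompact ℝ, ‖a x‖ < ε / 2 := by
    simpa using ha.eventually (Metric.ball_mem_nhds 0 (half_pos hε))
  obtain ⟨R, -, hR⟩ := (Metric.hasBasis_cobounded_compl_closedBall (0 : ℝ)).eventually_iff.1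
    (Metric.cobounded_eq_cocompact (α := ℝ) ▸ h)
  obtain ⟨N, hN⟩ := exists_nat_ge (R + 1)
  refine ⟨N, fun n hn => ?_⟩
  refine lt_of_le_of_lt ((BoundedContinuousFunction.dist_le (half_pos hε).le).2 fun x => ?_)
    (half_lt_self hε)
  have hx : dist ((a * cut n) x) (a x) = ‖a x‖ * ‖1 - cut n x‖ := by
    rw [dist_comm, dist_eq_norm, ← norm_mul, mul_sub, mul_one]
    rfl
  have hn' : (N : ℝ) ≤ n := by exact_mod_cast hn
  rw [hx]
  by_cases hxn : |x| ≤ R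
  · rw [cut_eq_one (by linarith)]
    simpa using (half_pos hε).le
  · have : ‖a x‖ < ε / 2 := hR (by simpa using hxn)
    nlinarith [norm_one_sub_cut_le n x, norm_nonneg (a x)]

/-! ### Compactness of `a(M)b(D)` -/

theorem isCompactOperator_sum {ι : Type*} (s : Finset ι) (T : ι → BddOp)
    (h : ∀ i ∈ s, IsCpt (T i)) : IsCpt (∑ i ∈ s, T i) :=
  (compactOperator (RingHom.id ℂ) L2R L2R).sum_mem h

/-- The product xξ is bounded on the supports, so the Taylor polynomials of e^{2πixξ}, which
separate x and ξ, converge uniformly there and give finite-rank approximants. -/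
theorem isCompactOperator_of_hasCompactSupport {a b : ℝ →ᵇ ℂ} (ha : HasCompactSupport a)
    (hb : HasCompactSupport b) : IsCpt (mulHom a * diffHom b) := by
  have hb' := hasCompactSupport_rescale hb
  obtain ⟨R, hR0, hR⟩ := exists_abs_le_of_hasCompactSupport ha
  obtain ⟨R', hR0', hR'⟩ := exists_abs_le_of_hasCompactSupport hb'
  set L := 2 * Real.pi * (R' * R)
  have hL0 : 0 ≤ L := by positivity
  have hlim : Tendsto (fun n : ℕ => L ^ n / n.factorial * 2 * ‖toL2 a‖ * ‖toL2 (rescale b)‖)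
      atTop (𝓝 0) := by
    simpa using (((FloorSemiring.tendsto_pow_div_factorial_atTop L).mul_const 2).mul_const
      ‖toL2 a‖).mul_const ‖toL2 (rescale b)‖
  -- This is the condition under which `Complex.exp_bound'` bounds the Taylor remainder by twice the
  -- first omitted term.
  have hev : ∀ᶠ n : ℕ in atTop, L / n.succ ≤ 1 / 2 := by
    obtain ⟨N, hN⟩ := exists_nat_ge (2 * L)
    filter_upwards [eventually_ge_atTop N] with n hn
    have : (N : ℝ) ≤ n := by exact_mod_cast hn
    rw [div_le_div_iff₀ (by positivity) two_pos]
    push_cast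
    linarith
  have hT : Tendsto (fun n : ℕ => ∑ k ∈ Finset.range n, InnerProductSpace.rankOne ℂ
      (toL2 fun x => a x * (x : ℂ) ^ k) (fourierL2.symm (toL2 fun ξ =>
        star (rescale b ξ * ((2 * Real.pi * ξ * Complex.I) ^ k / k.factorial)))))
      atTop (𝓝 (mulHom a * diffHom b)) := by
    rw [tendsto_iff_norm_sub_tendsto_zero]
    refine squeeze_zero' (.of_forall fun n => norm_nonneg _) ?_ hlim
    filter_upwards [hev] with n hn
    rw [norm_sub_rev]
    refine norm_mulHom_mul_diffHom_sub_le (Finset.range n) a b ha hb' (fun k x => (x : ℂ) ^ k)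
      (fun k ξ => (2 * Real.pi * ξ * Complex.I) ^ k / k.factorial) (fun k => by fun_prop)
      (fun k => by fun_prop) (by positivity) fun x ξ hx hξ => ?_
    set z : ℂ := (2 * Real.pi * (ξ * x) : ℝ) * Complex.I
    have hz : ‖z‖ ≤ L := by
      have h1 := hR x hx
      have h2 := hR' ξ hξ
      rw [norm_mul, Complex.norm_I, mul_one, Complex.norm_real, Real.norm_eq_abs, abs_mul,
        abs_of_pos Real.two_pi_pos, abs_mul]
      exact mul_le_mul_of_nonneg_left (mul_le_mul h2 h1 (abs_nonneg _) hR0'.le)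
        Real.two_pi_pos.le
    have hsum : ∑ k ∈ Finset.range n, (x : ℂ) ^ k *
        ((2 * Real.pi * ξ * Complex.I) ^ k / k.factorial) =
        ∑ k ∈ Finset.range n, z ^ k / k.factorial := by
      refine Finset.sum_congr rfl fun k _ => ?_
      rw [← mul_div_assoc, ← mul_pow]
      congr 2
      simp only [z]
      push_cast
      ring
    rw [hsum]
    refine (Complex.exp_bound' (le_trans (by gcongr) hn)).trans ?_
    gcongr
  exact isClosed_compactOps.mem_of_tendsto hT (.of_forall fun n =>
    isCompactOperator_sum _ _ fun k _ => isCompactOperator_rankOne _ _)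

/-- Cutting off both functions converges uniformly, hence in operator norm, and compactness is a
closed condition. -/
theorem isCompactOperator_mulHom_mul_diffHom {a b : ℝ →ᵇ ℂ} (ha : IsC0 a) (hb : IsC0 b) :
    IsCpt (mulHom a * diffHom b) := by
  have h : Tendsto (fun n : ℕ => mulHom (a * cut n) * diffHom (b * cut n)) atTop
      (𝓝 (mulHom a * diffHom b)) :=
    ((continuous_mulHom.tendsto a).comp ha.tendsto_mul_cut).mul
      ((continuous_diffHom.tendsto b).comp hb.tendsto_mul_cut)
  exact isClosed_compactOps.mem_of_tendsto h (.of_forall fun n =>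
    isCompactOperator_of_hasCompactSupport (hasCompactSupport_cut n).mul_left
      (hasCompactSupport_cut n).mul_left)

theorem isCompactOperator_diffHom_mul_mulHom {a b : ℝ →ᵇ ℂ} (ha : IsC0 a) (hb : IsC0 b) :
    IsCpt (diffHom b * mulHom a) := by
  have h := isCompactOperator_star (isCompactOperator_mulHom_mul_diffHom ha.star hb.star)
  rwa [star_mul, ← map_star, ← map_star, star_star, star_star] at h

end SemiPeriodic
end

/-! ### Rank-one operators as limits of localizations -/

noncomputable section
namespace SemiPeriodic

open InnerProductSpace

theorem mulHom_toL2 {a f : ℝ → ℂ} {b : ℝ →ᵇ ℂ} (hf : MemLp f 2 volume) (ha : MemLp a 2 volume)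
    (h : ∀ x, b x * f x = a x) : mulHom b (toL2 f) = toL2 a := by
  refine toL2_eq ha ?_
  filter_upwards [mulOp_apply_ae b (toL2 f), toL2_ae hf] with x h1 h2
  rw [mulHom_apply, h1, h2, h]

theorem mul_rankOne (T : BddOp) (u v : L2R) : T * rankOne ℂ u v = rankOne ℂ (T u) v :=
  comp_rankOne u v T

theorem rankOne_mul (T : BddOp) (u v : L2R) : rankOne ℂ u v * T = rankOne ℂ u (star T v) :=
  rankOne_comp u v T

theorem toL2_ne_zero {b : ℝ →ᵇ ℂ} (hb : HasCompactSupport b) {x : ℝ} (hx : b x ≠ 0) :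
    toL2 b ≠ 0 := by
  intro h0
  have h1 := toL2_ae (memLp_of_compact b.continuous hb)
  rw [h0] at h1
  have h2 : (b : ℝ → ℂ) = fun _ => (0 : ℂ) :=
    (Continuous.ae_eq_iff_eq volume b.continuous continuous_const).1
      (h1.symm.trans (Lp.coeFn_zero ℂ 2 volume))
  exact hx (congrFun h2 x)

/-- Localizing `b(D)` near the frequency `0` gives, after normalization, operators close to an
operator of rank one. -/
theorem exists_tendsto_rankOne {a : ℝ →ᵇ ℂ} (ha : HasCompactSupport a) :
    ∃ c : ℕ → ℂ, Tendsto (fun n : ℕ => c n • (mulHom a *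
      diffHom ((cut 1 * cut (1 / (n + 1))) ^ 2) * mulHom (star a))) atTop
      (𝓝 (rankOne ℂ (toL2 a) (toL2 a))) := by
  obtain ⟨R, hR0, hR⟩ := exists_abs_le_of_hasCompactSupport ha
  set r : ℕ → ℝ := fun n => 1 / (n + 1)
  have hr0 : ∀ n, 0 < r n := fun n => by positivity
  set b : ℕ → ℝ →ᵇ ℂ := fun n => cut 1 * cut (r n)
  have hbc : ∀ n, HasCompactSupport (b n) := fun n => (hasCompactSupport_cut (r n)).mul_left
  have hbs : ∀ n, star (b n) = b n := fun n => by
    simp only [b]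
    rw [star_mul, star_cut, star_cut, mul_comm]
  set A := ‖toL2 a‖
  set B : ℕ → ℝ := fun n => ‖toL2 (rescale (b n))‖
  have hB : ∀ n, 0 < B n := fun n => by
    refine norm_pos_iff.2 (toL2_ne_zero (hasCompactSupport_rescale (hbc n)) (x := 0) ?_)
    have : b n (2 * Real.pi * 0) = ((max 0 (min 1 (r n)) : ℝ) : ℂ) := by
      simp [b, cut_apply]
    rw [rescale_apply, this]
    have : 0 < max 0 (min 1 (r n)) := lt_max_of_lt_right (lt_min one_pos (hr0 n))
    exact_mod_cast this.ne'
  -- With this vector, a(M)b(D) is close to the rank-one operator obtained by replacing the Fourier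
  -- kernel by 1.
  set v : ℕ → L2R := fun n => fourierL2.symm (toL2 fun ξ => star (rescale (b n) ξ))
  have hv : ∀ n, ‖v n‖ = B n := fun n => by
    simp only [v, B]
    rw [LinearIsometryEquiv.norm_map]
    congr 2
    ext ξ
    exact congrArg (fun f : ℝ →ᵇ ℂ => f (2 * Real.pi * ξ)) (hbs n)
  set P : ℕ → BddOp := fun n => mulHom a * diffHom (b n)
  have hP : ∀ n, ‖P n - rankOne ℂ (toL2 a) (v n)‖ ≤ r n * R * A * B n := fun n => by
    have h := norm_mulHom_mul_diffHom_sub_le (Finset.univ : Finset Unit) a (b n) ha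
      (hasCompactSupport_rescale (hbc n)) (fun _ _ => 1) (fun _ _ => 1)
      (fun _ => continuous_const) (fun _ => continuous_const) (ε := r n * R)
      (by have := hr0 n; positivity) fun x ξ hx hξ => ?_
    · simp only [Finset.univ_unique, Finset.sum_singleton, mul_one] at h
      exact h
    -- On the supports |2πξ| ≤ r and |x| ≤ R, so the kernel differs from 1 by at most rR.
    · have h1 := hR x hx
      have h2 : |2 * Real.pi * ξ| ≤ r n := by
        by_contra hlt
        refine hξ ?_
        rw [rescale_apply]
        change cut 1 _ * cut (r n) _ = 0
        rw [cut_eq_zero (not_le.1 hlt).le, mul_zero]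
      have h3 : (2 * Real.pi * (ξ * x) : ℝ) = 2 * Real.pi * ξ * x := by ring
      rw [Finset.sum_const, mul_one, mul_comm _ Complex.I, h3]
      simp only [Finset.card_univ, Fintype.card_unit, one_smul]
      refine Real.norm_exp_I_mul_ofReal_sub_one_le.trans ?_
      rw [Real.norm_eq_abs, abs_mul]
      exact mul_le_mul h2 h1 (abs_nonneg _) (hr0 n).le
  have hR1 : ∀ n, rankOne ℂ (toL2 a) (v n) * star (rankOne ℂ (toL2 a) (v n)) =
      ((B n : ℂ) ^ 2) • rankOne ℂ (toL2 a) (toL2 a) := fun n => by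
    rw [ContinuousLinearMap.star_eq_adjoint, adjoint_rankOne, mul_rankOne, rankOne_apply,
      inner_self_eq_norm_sq_to_K, hv]
    simp
  -- The square in the symbol makes the operator PP*. As P is close to a rank-one Q, it is close to
  -- QQ*, where v enters only through its norm.
  have hPP : ∀ n, mulHom a * diffHom (b n ^ 2) * mulHom (star a) = P n * star (P n) := fun n => by
    simp only [P]
    rw [star_mul, ← map_star, ← map_star, hbs, pow_two, map_mul]
    simp only [mul_assoc]
  refine ⟨fun n => ((B n : ℂ) ^ 2)⁻¹, ?_⟩
  rw [tendsto_iff_norm_sub_tendsto_zero]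
  have hr : Tendsto r atTop (𝓝 0) := tendsto_one_div_add_atTop_nhds_zero_nat
  have hlim : Tendsto (fun n => r n * R * A * (A + (A + r n * R * A))) atTop (𝓝 0) := by
    have : Tendsto (fun n => r n * R * A * (A + (A + r n * R * A))) atTop
        (𝓝 (0 * R * A * (A + (A + 0 * R * A)))) :=
      ((hr.mul_const R).mul_const A).mul
        (((((hr.mul_const R).mul_const A).const_add A)).const_add A)
    simpa using this
  refine squeeze_zero (fun n => norm_nonneg _) (fun n => ?_) hlim
  set Q : BddOp := rankOne ℂ (toL2 a) (v n)
  have hQ : ‖Q‖ = A * B n := by rw [norm_rankOne, hv]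
  have hδ := hP n
  change ‖((B n : ℂ) ^ 2)⁻¹ • (mulHom a * diffHom (b n ^ 2) * mulHom (star a)) - _‖ ≤ _
  have hBne : ((B n : ℂ) ^ 2) ≠ 0 := pow_ne_zero _ (by exact_mod_cast (hB n).ne')
  -- PP* − QQ* is linear in the error P − Q; dividing by B² cancels the norms of v and leaves a
  -- bound proportional to r.
  have hdiff : ((B n : ℂ) ^ 2)⁻¹ • (mulHom a * diffHom (b n ^ 2) * mulHom (star a)) -
      rankOne ℂ (toL2 a) (toL2 a) =
      ((B n : ℂ) ^ 2)⁻¹ • (Q * star (P n - Q) + (P n - Q) * star (P n)) := by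
    have h1 : rankOne ℂ (toL2 a) (toL2 a) = ((B n : ℂ) ^ 2)⁻¹ • (Q * star Q) := by
      rw [hR1, smul_smul, inv_mul_cancel₀ hBne, one_smul]
    rw [h1, hPP, ← smul_sub, star_sub]
    congr 1
    noncomm_ring
  have hPn : ‖P n‖ ≤ A * B n + r n * R * A * B n := by
    calc ‖P n‖ = ‖Q + (P n - Q)‖ := by rw [add_sub_cancel]
      _ ≤ ‖Q‖ + ‖P n - Q‖ := norm_add_le _ _
      _ ≤ _ := by rw [hQ]; gcongr
  have hstar : ∀ S : BddOp, ‖star S‖ = ‖S‖ := fun S => norm_star S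
  have hBn := hB n
  have hr0n := hr0 n
  have hA : 0 ≤ A := norm_nonneg _
  rw [hdiff, norm_smul, norm_inv, norm_pow, Complex.norm_real, Real.norm_of_nonneg hBn.le,
    inv_mul_le_iff₀ (by positivity)]
  calc ‖Q * star (P n - Q) + (P n - Q) * star (P n)‖
      ≤ ‖Q‖ * ‖P n - Q‖ + ‖P n - Q‖ * ‖P n‖ := by
        refine (norm_add_le _ _).trans (add_le_add ?_ ?_)
        · exact (norm_mul_le _ _).trans_eq (by rw [hstar])
        · exact (norm_mul_le _ _).trans_eq (by rw [hstar])
    _ ≤ (A * B n) * (r n * R * A * B n) +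
        (r n * R * A * B n) * (A * B n + r n * R * A * B n) := by
        rw [hQ]; gcongr
    _ = B n ^ 2 * (r n * R * A * (A + (A + r n * R * A))) := by ring

/-- A closed subspace of operators that contains the localizations `f(M) b(D) g(M)` of suitable
`b` supported near `0` contains the compact operators. -/
theorem mem_of_isCpt {X : Submodule ℂ BddOp} (hX : IsClosed (X : Set BddOp))
    (h : ∀ f g : ℝ →ᵇ ℂ, HasCompactSupport f → HasCompactSupport g → ∀ r : ℝ,
      mulHom f * diffHom ((cut 1 * cut r) ^ 2) * mulHom g ∈ X) {T : BddOp} (hT : IsCpt T) :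
    T ∈ X := by
  have h1 : ∀ f g : ℝ →ᵇ ℂ, HasCompactSupport f → HasCompactSupport g →
      rankOne ℂ (toL2 f) (toL2 g) ∈ X := by
    intro f g hf hg
    obtain ⟨R₁, hR₁, hf'⟩ := exists_abs_le_of_hasCompactSupport hf
    obtain ⟨R₂, hR₂, hg'⟩ := exists_abs_le_of_hasCompactSupport hg
    -- This cut-off equals 1 on the supports of f and g, so multiplying the limit operator by f(M)
    -- and g(M) produces every such pair.
    set a := cut (R₁ + R₂ + 1)
    have ha : HasCompactSupport a := hasCompactSupport_cut _
    have hfa : mulHom f (toL2 a) = toL2 f := by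
      refine mulHom_toL2 (memLp_of_compact a.continuous ha) (memLp_of_compact f.continuous hf)
        fun x => ?_
      by_cases hx : f x = 0
      · simp [hx]
      · rw [cut_eq_one (by linarith [hf' x hx]), mul_one]
    have hga : mulHom g (toL2 a) = toL2 g := by
      refine mulHom_toL2 (memLp_of_compact a.continuous ha) (memLp_of_compact g.continuous hg)
        fun x => ?_
      by_cases hx : g x = 0
      · simp [hx]
      · rw [cut_eq_one (by linarith [hg' x hx]), mul_one]
    obtain ⟨c, hc⟩ := exists_tendsto_rankOne ha
    have hlim := (hc.const_mul (mulHom f)).mul_const (star (mulHom g))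
    rw [mul_rankOne, rankOne_mul, star_star, hfa, hga] at hlim
    refine hX.mem_of_tendsto hlim (.of_forall fun n => ?_)
    rw [mul_smul_comm, smul_mul_assoc]
    refine X.smul_mem _ ?_
    have := h (f * a) (star a * star g) hf.mul_right
      ((ha.comp_left (star_zero ℂ)).mul_right) (1 / (n + 1))
    rw [map_mul, map_mul, map_star mulHom g] at this
    simpa only [mul_assoc] using this
  have hdense : Dense {u : L2R | ∃ f : ℝ →ᵇ ℂ, HasCompactSupport f ∧ u = toL2 f} := by
    refine (Lp.dense_hasCompactSupport_contDiff (E := ℝ) (F := ℂ) (μ := volume) (p := 2)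
      ENNReal.ofNat_ne_top).mono ?_
    rintro u ⟨g, hug, hg, hgs⟩
    obtain ⟨C, hC⟩ := hg.exists_bound_of_continuous hgs.continuous
    exact ⟨BoundedContinuousFunction.ofNormedAddCommGroup g hgs.continuous C hC, hg,
      toL2_eq (memLp_of_compact hgs.continuous hg) hug⟩
  refine mem_of_isCompactOperator hX (fun u v => ?_) hT
  have h2 : ∀ f : ℝ →ᵇ ℂ, HasCompactSupport f → ∀ v, rankOne ℂ (toL2 f) v ∈ X := by
    intro f hf v
    refine hdense.induction (P := fun v => rankOne ℂ (toL2 f) v ∈ X) ?_ ?_ v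
    · rintro _ ⟨g, hg, rfl⟩
      exact h1 f g hf hg
    · exact hX.preimage (rankOne ℂ (toL2 f)).continuous
  refine hdense.induction (P := fun u => rankOne ℂ u v ∈ X) ?_ ?_ u
  · rintro _ ⟨f, hf, rfl⟩
    exact h2 f hf v
  -- Continuity in the first vector is obtained from continuity in `rankOne ℂ v` through the
  -- adjoint.
  · have hc : Continuous fun u => (star (rankOne ℂ v u) : BddOp) :=
      continuous_star.comp (rankOne ℂ v).continuous
    refine hX.preimage (hc.congr fun u => ?_)
    rw [ContinuousLinearMap.star_eq_adjoint, adjoint_rankOne]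

end SemiPeriodic
end

/-! ### Commutators with c(D) modulo compact operators -/

noncomputable section
namespace SemiPeriodic

/-- The continuous step `x ↦ min 1 (x / l + 1)⁺` from `0` to `1`. -/
def step (l : ℝ) : ℝ →ᵇ ℂ :=
  BoundedContinuousFunction.ofNormedAddCommGroup
    (fun x : ℝ => ((max 0 (min 1 (x / l + 1)) : ℝ) : ℂ)) (by fun_prop) 1 (fun x => by
      rw [Complex.norm_real, Real.norm_of_nonneg (le_max_left _ _)]
      exact max_le zero_le_one (min_le_left _ _))

theorem step_apply (l x : ℝ) : step l x = ((max 0 (min 1 (x / l + 1)) : ℝ) : ℂ) := rfl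

theorem step_eq_one {l x : ℝ} (hl : 0 < l) (hx : 0 ≤ x) : step l x = 1 := by
  have : 0 ≤ x / l := by positivity
  rw [step_apply, min_eq_left (by linarith), max_eq_right zero_le_one, Complex.ofReal_one]

theorem step_eq_zero {l x : ℝ} (hl : 0 < l) (hx : x ≤ -l) : step l x = 0 := by
  have : x / l ≤ -1 := by rw [div_le_iff₀ hl]; linarith
  rw [step_apply, max_eq_left (min_le_of_right_le (by linarith)), Complex.ofReal_zero]

theorem isC0_of_hasCompactSupport {b : ℝ →ᵇ ℂ} (hb : HasCompactSupport b) : IsC0 b :=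
  hb.is_zero_at_infty

theorem hasCompactSupport_step_sub {l : ℝ} (hl : 1 ≤ l) :
    HasCompactSupport (step 1 - step l) := by
  refine hasCompactSupport_of_abs (R := l) fun x hx => ?_
  change step 1 x - step l x = 0
  rcases le_total 0 x with h | h
  · rw [step_eq_one one_pos h, step_eq_one (by linarith) h, sub_self]
  · rw [abs_of_nonpos h] at hx
    rw [step_eq_zero one_pos (by linarith), step_eq_zero (by linarith) (by linarith), sub_self]

/-- The ramp has slope 1/l: slow steps are almost translation invariant. -/
theorem norm_shift_step_sub_le {l : ℝ} (hl : 0 < l) (t : ℝ) :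
    ‖shift t (step l) - step l‖ ≤ |t| / l := by
  refine (BoundedContinuousFunction.norm_le (by positivity)).2 fun x => ?_
  change ‖step l (x - t) - step l x‖ ≤ _
  rw [step_apply, step_apply, ← Complex.ofReal_sub, Complex.norm_real, Real.norm_eq_abs]
  refine (abs_max_sub_max_le_max _ _ _ _).trans ?_
  rw [sub_self, abs_zero]
  refine max_le (by positivity) ((abs_min_sub_min_le_max _ _ _ _).trans ?_)
  rw [sub_self, abs_zero]
  refine max_le (by positivity) (le_of_eq ?_)
  have : (x - t) / l + 1 - (x / l + 1) = -(t / l) := by ring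
  rw [this, abs_neg, abs_div, abs_of_pos hl]

theorem norm_expR_le (t : ℝ) : ‖mulHom (expR t)‖ ≤ 1 :=
  (norm_mulHom_le _).trans (BoundedContinuousFunction.norm_ofNormedAddCommGroup_le _ zero_le_one _)

theorem norm_commutator_expR_le {l : ℝ} (hl : 0 < l) (t : ℝ) :
    ‖mulHom (expR t) * diffHom (step l) - diffHom (step l) * mulHom (expR t)‖ ≤ |t| / l := by
  rw [mulHom_expR_mul_diffHom, ← sub_mul, ← map_sub]
  refine (norm_mul_le _ _).trans ?_
  calc _ ≤ |t| / l * 1 := by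
        gcongr
        · exact (norm_diffHom_le _).trans (norm_shift_step_sub_le hl t)
        · exact norm_expR_le t
    _ = _ := mul_one _

/-- If `a` is the inverse Fourier transform of `f`, then `a(M)` is, weakly, the integral of the
modulations against `f`. -/
theorem inner_mulHom_fourierInv {a : ℝ →ᵇ ℂ} {f : ℝ → ℂ} (hf : Integrable f)
    (ha : ∀ x, a x = (𝓕⁻ f) x) (u v : L2R) :
    Integrable (fun t => f t * inner ℂ v (mulHom (expR (2 * Real.pi * t)) u)) ∧
      inner ℂ v (mulHom a u) =
        ∫ t, f t * inner ℂ v (mulHom (expR (2 * Real.pi * t)) u) := by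
  have huv : Integrable fun x => u x * (starRingEnd ℂ) (v x) := by
    refine (L2.integrable_inner v u).congr (ae_of_all _ fun x => ?_)
    simp
  have hF : Integrable (fun p : ℝ × ℝ => expR (2 * Real.pi * p.1) p.2 *
      (f p.1 * (u p.2 * (starRingEnd ℂ) (v p.2)))) (volume.prod volume) := by
    refine (hf.mul_prod huv).bdd_mul (c := 1) ?_ ?_
    · simp_rw [expR_apply]
      exact (by fun_prop : Continuous fun p : ℝ × ℝ =>
        Complex.exp ((2 * Real.pi * p.1 * p.2 : ℝ) * Complex.I)).aestronglyMeasurable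
    · exact ae_of_all _ fun p => (Complex.norm_exp_ofReal_mul_I _).le
  have hin : ∀ t, f t * inner ℂ v (mulHom (expR (2 * Real.pi * t)) u) =
      ∫ x, expR (2 * Real.pi * t) x * (f t * (u x * (starRingEnd ℂ) (v x))) := by
    intro t
    rw [L2.inner_def, ← integral_const_mul]
    refine integral_congr_ae ?_
    filter_upwards [mulOp_apply_ae (expR (2 * Real.pi * t)) u] with x hx
    rw [mulHom_apply, hx, RCLike.inner_apply]
    ring
  refine ⟨hF.integral_prod_left.congr (ae_of_all _ fun t => (hin t).symm), ?_⟩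
  simp_rw [hin]
  rw [integral_integral_swap hF, L2.inner_def]
  refine integral_congr_ae ?_
  filter_upwards [mulOp_apply_ae a u] with x hx
  rw [mulHom_apply, hx, RCLike.inner_apply, ha, fourierInv_eq_integral, mul_assoc,
    ← integral_mul_const]
  refine integral_congr_ae (ae_of_all _ fun t => ?_)
  simp only [expR_apply, ← mul_assoc]

/-- Weakly, the commutator is the integral of f(t) times the commutators of e^{2πitM}, each of norm
at most 2π|t|/l. -/
theorem norm_commutator_le {a : ℝ →ᵇ ℂ} {f : ℝ → ℂ} (hf : Integrable f)
    (hf' : Integrable fun t => ‖f t‖ * (2 * Real.pi * |t|))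
    (ha : ∀ x, a x = (𝓕⁻ f) x) {l : ℝ} (hl : 0 < l) :
    ‖mulHom a * diffHom (step l) - diffHom (step l) * mulHom a‖ ≤
      (∫ t, ‖f t‖ * (2 * Real.pi * |t|)) / l := by
  set C := ∫ t, ‖f t‖ * (2 * Real.pi * |t|)
  have hC : 0 ≤ C := integral_nonneg fun t => by have := Real.two_pi_pos; positivity
  set B := diffHom (step l)
  set T := mulHom a * B - B * mulHom a
  have key : ∀ u v : L2R, ‖inner ℂ v (T u)‖ ≤ C / l * ‖u‖ * ‖v‖ := by
    intro u v
    obtain ⟨i1, e1⟩ := inner_mulHom_fourierInv hf ha (B u) v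
    obtain ⟨i2, e2⟩ := inner_mulHom_fourierInv hf ha u (star B v)
    have hB : ∀ w, inner ℂ (star B v) w = inner ℂ v (B w) := fun w => by
      rw [ContinuousLinearMap.star_eq_adjoint, ContinuousLinearMap.adjoint_inner_left]
    rw [hB] at e2
    have hT : inner ℂ v (T u) = ∫ t, f t * inner ℂ v
        ((mulHom (expR (2 * Real.pi * t)) * B - B * mulHom (expR (2 * Real.pi * t))) u) := by
      change inner ℂ v (mulHom a (B u) - B (mulHom a u)) = _
      rw [inner_sub_right, e1, e2, ← integral_sub i1 i2]
      refine integral_congr_ae (ae_of_all _ fun t => ?_)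
      simp only [hB, sub_apply, mul_apply_eq_comp, inner_sub_right, mul_sub]
    rw [hT]
    refine (norm_integral_le_of_norm_le (hf'.mul_const (‖u‖ * ‖v‖ / l))
      (ae_of_all _ fun t => ?_)).trans (le_of_eq ?_)
    · rw [norm_mul]
      calc _ ≤ ‖f t‖ * (‖v‖ * (|2 * Real.pi * t| / l * ‖u‖)) := by
            gcongr
            exact (norm_inner_le_norm _ _).trans (mul_le_mul_of_nonneg_left
              (ContinuousLinearMap.le_of_opNorm_le _ (norm_commutator_expR_le hl _) u)
              (norm_nonneg v))
        _ = _ := by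
            rw [abs_mul, abs_of_pos Real.two_pi_pos]
            ring
    · rw [integral_mul_const]
      ring
  refine ContinuousLinearMap.opNorm_le_bound _ (by positivity) fun u => ?_
  -- Testing against v = Tu turns the bound on the form into a bound on the norm.
  have h := key u (T u)
  rw [inner_self_eq_norm_sq_to_K, norm_pow, RCLike.norm_ofReal, abs_norm] at h
  by_cases h0 : ‖T u‖ = 0
  · rw [h0]; positivity
  · exact le_of_mul_le_mul_right (by rw [← pow_two]; exact h)
      (lt_of_le_of_ne (norm_nonneg _) (Ne.symm h0))

/-- Split the step as (step 1 − step l) + step l. The first part has compact support and contributes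
compact operators; the commutator with the second is O(1/l). -/
theorem isCpt_commutator_of_schwartz {a : ℝ →ᵇ ℂ} (g : SchwartzMap ℝ ℂ) (hag : ∀ x, a x = g x)
    (ha : IsC0 a) :
    IsCpt (mulHom a * diffHom (step 1) - diffHom (step 1) * mulHom a) := by
  set f : SchwartzMap ℝ ℂ := 𝓕 g
  have hg : ∀ x, a x = (𝓕⁻ (f : ℝ → ℂ)) x := fun x => by
    rw [hag, ← SchwartzMap.fourierInv_coe]
    simp [f]
  have hf' : Integrable fun t => ‖f t‖ * (2 * Real.pi * |t|) := by
    refine ((f.integrable_pow_mul volume 1).const_mul (2 * Real.pi)).congr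
      (ae_of_all _ fun t => ?_)
    simp only [pow_one, Real.norm_eq_abs]
    ring
  have hlim : Tendsto (fun n : ℕ => mulHom a * diffHom (step 1 - step (n + 1)) -
      diffHom (step 1 - step (n + 1)) * mulHom a) atTop
      (𝓝 (mulHom a * diffHom (step 1) - diffHom (step 1) * mulHom a)) := by
    rw [tendsto_iff_norm_sub_tendsto_zero]
    have h0 : Tendsto (fun n : ℕ => (∫ t, ‖f t‖ * (2 * Real.pi * |t|)) / ((n : ℝ) + 1))
        atTop (𝓝 0) := by
      simpa [div_eq_mul_inv] using
        (tendsto_one_div_add_atTop_nhds_zero_nat (𝕜 := ℝ)).const_mul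
          (∫ t, ‖f t‖ * (2 * Real.pi * |t|))
    refine squeeze_zero (fun n => norm_nonneg _) (fun n => ?_) h0
    refine le_trans (le_of_eq ?_) (norm_commutator_le f.integrable hf' hg
      (l := (n : ℝ) + 1) (by positivity))
    rw [map_sub, ← norm_neg]
    congr 1
    noncomm_ring
  refine isClosed_compactOps.mem_of_tendsto hlim (.of_forall fun n => ?_)
  have hs : IsC0 (step 1 - step (n + 1)) :=
    isC0_of_hasCompactSupport (hasCompactSupport_step_sub (by simp))
  exact IsCompactOperator.sub (isCompactOperator_mulHom_mul_diffHom ha hs)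
    (isCompactOperator_diffHom_mul_mulHom ha hs)

/-- `a(M)` with `a ∈ C₀(ℝ)` commutes with `b(D)` modulo compact operators, for the step `b`. -/
theorem isCpt_commutator {a : ℝ →ᵇ ℂ} (ha : IsC0 a) :
    IsCpt (mulHom a * diffHom (step 1) - diffHom (step 1) * mulHom a) := by
  have hcl : IsClosed {a : ℝ →ᵇ ℂ |
      IsCpt (mulHom a * diffHom (step 1) - diffHom (step 1) * mulHom a)} :=
    isClosed_compactOps.preimage ((continuous_mulHom.mul continuous_const).sub
      (continuous_const.mul continuous_mulHom))
  -- First reduce to compactly supported functions, then approximate these uniformly by smooth ones,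
  -- which are Schwartz.
  refine hcl.mem_of_tendsto ha.tendsto_mul_cut (.of_forall fun n => ?_)
  have hc : HasCompactSupport (a * cut n) := (hasCompactSupport_cut n).mul_left
  refine hcl.closure_subset (Metric.mem_closure_iff.2 fun ε hε => ?_)
  obtain ⟨g, hg, hgd, hgs⟩ := (a * cut n).continuous.exists_contDiff_approx (⊤ : ℕ∞)
    (ε := fun _ => ε / 2) continuous_const (fun _ => half_pos hε)
  have hgc : HasCompactSupport g := hc.mono hgs
  obtain ⟨C, hC⟩ := hgc.exists_bound_of_continuous hg.continuous
  set b : ℝ →ᵇ ℂ := BoundedContinuousFunction.ofNormedAddCommGroup g hg.continuous C hC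
  refine ⟨b, isCpt_commutator_of_schwartz (hgc.toSchwartzMap hg) (fun x => rfl)
    (isC0_of_hasCompactSupport (b := b) hgc), ?_⟩
  refine lt_of_le_of_lt ((BoundedContinuousFunction.dist_le (half_pos hε).le).2 fun x => ?_)
    (half_lt_self hε)
  rw [dist_comm]
  exact (hgd x).le

end SemiPeriodic
end

noncomputable section
namespace SemiPeriodic

/-! ### Limits along modulations -/

/-- The operator `e^{-itM} T e^{itM}`. -/
def modConj (t : ℝ) (T : BddOp) : BddOp := mulHom (expR (-t)) * T * mulHom (expR t)

theorem modConj_mul (t : ℝ) (S T : BddOp) : modConj t (S * T) = modConj t S * modConj t T := by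
  have h : mulHom (expR t) * mulHom (expR (-t)) = 1 := by
    rw [← map_mul, ← expR_add, add_neg_cancel, expR_zero, map_one]
  calc modConj t (S * T) = mulHom (expR (-t)) * S * 1 * T * mulHom (expR t) := by
        simp only [modConj, mul_assoc, mul_one]
    _ = _ := by rw [← h]; simp only [modConj, mul_assoc]

theorem modConj_add (t : ℝ) (S T : BddOp) : modConj t (S + T) = modConj t S + modConj t T := by
  simp only [modConj, mul_add, add_mul]

theorem modConj_smul (t : ℝ) (c : ℂ) (T : BddOp) : modConj t (c • T) = c • modConj t T := by
  simp only [modConj, mul_smul_comm, smul_mul_assoc]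

theorem norm_modConj_le (t : ℝ) (T : BddOp) : ‖modConj t T‖ ≤ ‖T‖ := by
  calc ‖modConj t T‖ ≤ ‖mulHom (expR (-t))‖ * ‖T‖ * ‖mulHom (expR t)‖ :=
        (norm_mul_le _ _).trans (by gcongr; exact norm_mul_le _ _)
    _ ≤ 1 * ‖T‖ * 1 := by gcongr <;> exact norm_expR_le _
    _ = ‖T‖ := by ring

theorem norm_modConj_apply_le (t : ℝ) (T : BddOp) (u : L2R) : ‖modConj t T u‖ ≤ ‖T‖ * ‖u‖ :=
  ContinuousLinearMap.le_of_opNorm_le _ (norm_modConj_le t T) u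

theorem modConj_mulHom (t : ℝ) (a : ℝ →ᵇ ℂ) : modConj t (mulHom a) = mulHom a := by
  rw [modConj, ← map_mul, ← map_mul, mul_comm (expR (-t)), mul_assoc, ← expR_add, neg_add_cancel,
    expR_zero, mul_one]

theorem modConj_diffHom (t : ℝ) (b : ℝ →ᵇ ℂ) : modConj t (diffHom b) = diffHom (shift (-t) b) := by
  rw [modConj, mulHom_expR_mul_diffHom, mul_assoc, ← map_mul, ← expR_add, neg_add_cancel,
    expR_zero, map_one, mul_one]

/-- `S` is the strong limit of `e^{-iσnM} T e^{iσnM}` as `n → ∞`. -/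
def HasLim (σ : ℝ) (T S : BddOp) : Prop :=
  ∀ u, Tendsto (fun n : ℕ => modConj (σ * n) T u) atTop (𝓝 (S u))

variable {σ : ℝ} {S S' T T' : BddOp}

theorem HasLim.add (h : HasLim σ T S) (h' : HasLim σ T' S') : HasLim σ (T + T') (S + S') :=
  fun u => ((h u).add (h' u)).congr fun n => by rw [modConj_add]; rfl

theorem HasLim.smul (c : ℂ) (h : HasLim σ T S) : HasLim σ (c • T) (c • S) :=
  fun u => ((h u).const_smul c).congr fun n => by rw [modConj_smul]; rfl

theorem HasLim.neg (h : HasLim σ T S) : HasLim σ (-T) (-S) := by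
  simpa using h.smul (-1)

theorem HasLim.sub (h : HasLim σ T S) (h' : HasLim σ T' S') : HasLim σ (T - T') (S - S') := by
  simpa only [sub_eq_add_neg] using h.add h'.neg

/-- Strong limits multiply because the conjugates of T are bounded by ‖T‖ uniformly in n. -/
theorem HasLim.mul (h : HasLim σ T S) (h' : HasLim σ T' S') : HasLim σ (T * T') (S * S') := by
  intro u
  have h1 : Tendsto (fun n : ℕ => modConj (σ * n) T (modConj (σ * n) T' u - S' u)) atTop
      (𝓝 0) := by
    have h2 : Tendsto (fun n : ℕ => ‖T‖ * ‖modConj (σ * n) T' u - S' u‖) atTop (𝓝 0) := by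
      simpa using (tendsto_iff_norm_sub_tendsto_zero.1 (h' u)).const_mul ‖T‖
    exact squeeze_zero_norm (fun n => norm_modConj_apply_le _ _ _) h2
  have h3 := h1.add (h (S' u))
  rw [zero_add] at h3
  refine h3.congr fun n => ?_
  rw [map_sub, sub_add_cancel, modConj_mul]
  rfl

theorem hasLim_mulHom (σ : ℝ) (a : ℝ →ᵇ ℂ) : HasLim σ (mulHom a) (mulHom a) := fun u => by
  simp_rw [modConj_mulHom]
  exact tendsto_const_nhds

/-- Conjugation gives b(D + σn), whose symbols are bounded and converge pointwise to the constant l.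
-/
theorem hasLim_diffHom {b : ℝ →ᵇ ℂ} {l : ℂ}
    (h : ∀ x : ℝ, Tendsto (fun n : ℕ => b (x + σ * n)) atTop (𝓝 l)) :
    HasLim σ (diffHom b) (mulHom (algebraMap ℂ _ l)) := by
  intro u
  rw [AlgHomClass.commutes, ← AlgHomClass.commutes diffHom l,
    tendsto_iff_norm_sub_tendsto_zero, ← tendsto_zero_iff_norm_tendsto_zero]
  have h1 := tendsto_diffHom_zero (b := fun n : ℕ => shift (-(σ * n)) b - algebraMap ℂ _ l)
    (C := ‖b‖ + ‖(algebraMap ℂ (ℝ →ᵇ ℂ) l)‖) (fun n => ?_) (fun x => ?_) u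
  · refine h1.congr fun n => ?_
    rw [map_sub, modConj_diffHom]
    rfl
  · refine (norm_sub_le _ _).trans (add_le_add_left ?_ _)
    exact (BoundedContinuousFunction.norm_le (norm_nonneg _)).2 fun x => b.norm_coe_le_norm _
  · have h2 := (h x).sub_const l
    rw [sub_self] at h2
    refine h2.congr fun n => ?_
    change _ = b (x - -(σ * n)) - l
    rw [sub_neg_eq_add]

theorem HasLim.norm_le (h : HasLim σ T S) : ‖S‖ ≤ ‖T‖ :=
  ContinuousLinearMap.opNorm_le_bound _ (norm_nonneg _) fun u =>
    le_of_tendsto (h u).norm (.of_forall fun _ => norm_modConj_apply_le _ _ u)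

/-- The uniform bound on the conjugates of S is enough; S need not have a limit itself. -/
theorem HasLim.mul_left_zero (S : BddOp) (h : HasLim σ T 0) : HasLim σ (S * T) 0 := by
  intro u
  have h0 : Tendsto (fun n : ℕ => modConj (σ * n) T u) atTop (𝓝 0) := h u
  have h2 : Tendsto (fun n : ℕ => ‖S‖ * ‖modConj (σ * n) T u‖) atTop (𝓝 0) := by
    simpa using h0.norm.const_mul ‖S‖
  change Tendsto _ _ (𝓝 0)
  refine squeeze_zero_norm (fun n => ?_) h2
  rw [modConj_mul, mul_apply_eq_comp]
  exact norm_modConj_apply_le _ _ _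

theorem isClosed_hasLim_zero (σ : ℝ) : IsClosed {T : BddOp | HasLim σ T 0} := by
  refine isClosed_of_closure_subset fun T hT u => ?_
  change Tendsto _ _ (𝓝 0)
  rw [Metric.tendsto_atTop]
  intro ε hε
  have hpos : 0 < ε / (2 * (‖u‖ + 1)) := by positivity
  obtain ⟨T', hT', hd⟩ := Metric.mem_closure_iff.1 hT _ hpos
  obtain ⟨N, hN⟩ := Metric.tendsto_atTop.1 (hT' u) (ε / 2) (half_pos hε)
  refine ⟨N, fun n hn => ?_⟩
  have h1 := hN n hn
  change dist _ (0 : L2R) < _ at h1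
  rw [dist_zero_right] at h1 ⊢
  have h2 : modConj (σ * n) T u = modConj (σ * n) (T - T') u + modConj (σ * n) T' u := by
    have h3 := congrArg (fun A : BddOp => A u) (modConj_add (σ * n) (T - T') T')
    rw [sub_add_cancel] at h3
    exact h3
  have h4 : ‖modConj (σ * n) (T - T') u‖ ≤ ε / 2 := by
    refine (norm_modConj_apply_le _ _ _).trans ?_
    rw [← dist_eq_norm]
    calc dist T T' * ‖u‖ ≤ ε / (2 * (‖u‖ + 1)) * (‖u‖ + 1) := by
          gcongr
          linarith
      _ = ε / 2 := by field_simp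
  rw [h2]
  linarith [norm_add_le (modConj (σ * n) (T - T') u) (modConj (σ * n) T' u)]

/-! ### The commutator ideal -/

/-- The generators of the algebra `𝒜`. -/
def genA : Set BddOp :=
  {T | ∃ a ∈ CS, T = mulOp a} ∪ {T | ∃ j : ℤ, T = mulOp (expFun j)} ∪ {T | ∃ b ∈ CS, T = diffOp b}

theorem tendsto_comp_add {b : ℝ → ℂ} {l : ℂ} (h : Tendsto b atTop (𝓝 l)) (x : ℝ) :
    Tendsto (fun n : ℕ => b (x + 1 * n)) atTop (𝓝 l) := by
  simp_rw [one_mul]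
  exact h.comp (tendsto_atTop_add_const_left _ x tendsto_natCast_atTop_atTop)

theorem tendsto_comp_sub {b : ℝ → ℂ} {l : ℂ} (h : Tendsto b atBot (𝓝 l)) (x : ℝ) :
    Tendsto (fun n : ℕ => b (x + -1 * n)) atTop (𝓝 l) := by
  simp_rw [neg_one_mul]
  exact h.comp (tendsto_atBot_add_const_left _ x
    (tendsto_neg_atTop_atBot.comp tendsto_natCast_atTop_atTop))

theorem CS.star {b : ℝ →ᵇ ℂ} (hb : b ∈ CS) : star b ∈ CS := by
  obtain ⟨⟨l, hl⟩, ⟨m, hm⟩⟩ := hb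
  exact ⟨⟨_, (continuous_star.tendsto l).comp hl⟩, ⟨_, (continuous_star.tendsto m).comp hm⟩⟩

theorem exists_hasLim_diffHom (hσ : σ = 1 ∨ σ = -1) {b : ℝ →ᵇ ℂ} (hb : b ∈ CS) :
    ∃ a, HasLim σ (diffHom b) (mulHom a) := by
  obtain ⟨⟨l, hl⟩, ⟨m, hm⟩⟩ := hb
  rcases hσ with rfl | rfl
  · exact ⟨_, hasLim_diffHom (tendsto_comp_add hl)⟩
  · exact ⟨_, hasLim_diffHom (tendsto_comp_sub hm)⟩

/-- The adjoint is carried through the induction because strong convergence does not pass to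
adjoints. -/
theorem exists_hasLim (hσ : σ = 1 ∨ σ = -1) (hT : T ∈ StarAlgebra.adjoin ℂ genA) :
    (∃ a, HasLim σ T (mulHom a)) ∧ ∃ a, HasLim σ (star T) (mulHom a) := by
  induction hT using StarAlgebra.adjoin_induction with
  | mem T hT =>
    rcases hT with (⟨a, -, rfl⟩ | ⟨j, rfl⟩) | ⟨b, hb, rfl⟩
    · rw [← mulHom_apply, ← map_star]
      exact ⟨⟨_, hasLim_mulHom σ a⟩, ⟨_, hasLim_mulHom σ (star a)⟩⟩
    · rw [← mulHom_apply, ← map_star]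
      exact ⟨⟨_, hasLim_mulHom σ _⟩, ⟨_, hasLim_mulHom σ _⟩⟩
    · rw [← diffHom_apply, ← map_star]
      exact ⟨exists_hasLim_diffHom hσ hb, exists_hasLim_diffHom hσ (CS.star hb)⟩
  | algebraMap r =>
    rw [← AlgHomClass.commutes mulHom r, ← map_star]
    exact ⟨⟨_, hasLim_mulHom σ _⟩, ⟨_, hasLim_mulHom σ _⟩⟩
  | add S T _ _ hS hT =>
    obtain ⟨⟨a, ha⟩, ⟨a', ha'⟩⟩ := hS
    obtain ⟨⟨b, hb⟩, ⟨b', hb'⟩⟩ := hT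
    rw [star_add]
    exact ⟨⟨a + b, by rw [map_add]; exact ha.add hb⟩,
      ⟨a' + b', by rw [map_add]; exact ha'.add hb'⟩⟩
  | mul S T _ _ hS hT =>
    obtain ⟨⟨a, ha⟩, ⟨a', ha'⟩⟩ := hS
    obtain ⟨⟨b, hb⟩, ⟨b', hb'⟩⟩ := hT
    rw [star_mul]
    exact ⟨⟨a * b, by rw [map_mul]; exact ha.mul hb⟩,
      ⟨b' * a', by rw [map_mul]; exact hb'.mul ha'⟩⟩
  | star T _ hT =>
    rw [star_star]
    exact ⟨hT.2, hT.1⟩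

/-- On the dense ⋆-algebra the limits are multiplications and commute. Having limit 0 is a closed
condition, so the existence of limits on the closure is not needed. -/
theorem hasLim_commutator (hσ : σ = 1 ∨ σ = -1) (hS : S ∈ algA) (hT : T ∈ algA) :
    HasLim σ (S * T - T * S) 0 := by
  have h1 : ∀ S ∈ StarAlgebra.adjoin ℂ genA, ∀ T ∈ closure (StarAlgebra.adjoin ℂ genA : Set BddOp),
      HasLim σ (S * T - T * S) 0 := by
    intro S hS T hT
    refine closure_minimal (t := {T | HasLim σ (S * T - T * S) 0}) (fun T hT => ?_) ?_ hT
    · obtain ⟨⟨a, ha⟩, -⟩ := exists_hasLim hσ hS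
      obtain ⟨⟨b, hb⟩, -⟩ := exists_hasLim hσ hT
      have h := (ha.mul hb).sub (hb.mul ha)
      rwa [← map_mul, ← map_mul, mul_comm b a, sub_self] at h
    · exact (isClosed_hasLim_zero σ).preimage
        ((continuous_const.mul continuous_id).sub (continuous_id.mul continuous_const))
  refine closure_minimal (t := {S | HasLim σ (S * T - T * S) 0}) (fun S hS => h1 S hS T hT) ?_ hS
  exact (isClosed_hasLim_zero σ).preimage
    ((continuous_id.mul continuous_const).sub (continuous_const.mul continuous_id))

/-- Unlike on the left, a uniform bound on the conjugates of S does not suffice: S is approximated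
in norm by operators that do have limits. -/
theorem HasLim.mul_right_zero (hσ : σ = 1 ∨ σ = -1) (h : HasLim σ T 0) (hS : S ∈ algA) :
    HasLim σ (T * S) 0 := by
  refine closure_minimal (t := {S | HasLim σ (T * S) 0}) (fun S hS => ?_) ?_ hS
  · obtain ⟨⟨a, ha⟩, -⟩ := exists_hasLim hσ hS
    have h1 := h.mul ha
    rwa [zero_mul] at h1
  · exact (isClosed_hasLim_zero σ).preimage (continuous_const.mul continuous_id)

/-- The elements of 𝒜 with limit 0 form a closed two-sided ideal containing the commutators. -/
theorem hasLim_of_mem_commIdeal (hσ : σ = 1 ∨ σ = -1) (hT : T ∈ commIdeal) : HasLim σ T 0 := by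
  obtain ⟨A, hA, rfl⟩ := hT
  let I : TwoSidedIdeal algA := TwoSidedIdeal.mk' {A : algA | HasLim σ (A : BddOp) 0}
    (fun u => by simpa using (hasLim_mulHom σ 0 u))
    (fun hx hy => by simpa using HasLim.add hx hy)
    (fun hx => by simpa using HasLim.neg hx)
    (fun hy => HasLim.mul_left_zero _ hy)
    (fun {x y} hx => HasLim.mul_right_zero hσ hx y.2)
  have hI : TwoSidedIdeal.span {T : algA | ∃ A B : algA, T = A * B - B * A} ≤ I := by
    rw [TwoSidedIdeal.span_le]
    rintro _ ⟨A, B, rfl⟩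
    refine (TwoSidedIdeal.mem_mk' _ _ _ _ _ _ _).2 ?_
    exact hasLim_commutator hσ A.2 B.2
  refine closure_minimal (t := {A : algA | HasLim σ (A : BddOp) 0}) (fun A hA => ?_) ?_ hA
  · exact (TwoSidedIdeal.mem_mk' _ _ _ _ _ _ A).1 (hI hA)
  · exact (isClosed_hasLim_zero σ).preimage continuous_subtype_val

end SemiPeriodic
end

noncomputable section
namespace SemiPeriodic

/-! ### Symbols of elements of `J₀` -/

theorem IsC0.tendsto_atTop {b : ℝ →ᵇ ℂ} (hb : IsC0 b) : Tendsto b atTop (𝓝 0) :=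
  hb.mono_left atTop_le_cocompact

theorem IsC0.tendsto_atBot {b : ℝ →ᵇ ℂ} (hb : IsC0 b) : Tendsto b atBot (𝓝 0) :=
  hb.mono_left atBot_le_cocompact

theorem IsC0.mem_CS {b : ℝ →ᵇ ℂ} (hb : IsC0 b) : b ∈ CS :=
  ⟨⟨0, hb.tendsto_atTop⟩, ⟨0, hb.tendsto_atBot⟩⟩

theorem IsC0.add {a b : ℝ →ᵇ ℂ} (ha : IsC0 a) (hb : IsC0 b) : IsC0 (a + b) := by
  have h := Tendsto.add ha hb
  rw [add_zero] at h
  exact h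

theorem IsC0.smul (c : ℂ) {a : ℝ →ᵇ ℂ} (ha : IsC0 a) : IsC0 (c • a) := by
  have h := Tendsto.const_smul ha c
  rw [smul_zero] at h
  exact h

theorem isC0_zero : IsC0 0 := tendsto_const_nhds

theorem tendsto_step_atTop : Tendsto (step 1) atTop (𝓝 1) :=
  tendsto_const_nhds.congr' ((eventually_ge_atTop 0).mono fun _ hx => (step_eq_one one_pos hx).symm)

theorem tendsto_step_atBot : Tendsto (step 1) atBot (𝓝 0) :=
  tendsto_const_nhds.congr'
    ((eventually_le_atBot (-1)).mono fun _ hx => (step_eq_zero one_pos hx).symm)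

theorem step_mem_CS : step 1 ∈ CS := ⟨⟨1, tendsto_step_atTop⟩, ⟨0, tendsto_step_atBot⟩⟩

theorem isC0_of_tendsto {b : ℝ →ᵇ ℂ} (h : Tendsto b atTop (𝓝 0)) (h' : Tendsto b atBot (𝓝 0)) :
    IsC0 b := by
  rw [IsC0, cocompact_eq_atBot_atTop]
  exact h'.sup h

theorem isC0_sub_of_tendsto {b : ℝ →ᵇ ℂ} {l m : ℂ} (hl : Tendsto b atTop (𝓝 l))
    (hm : Tendsto b atBot (𝓝 m)) : IsC0 (b - (l • step 1 + m • (1 - step 1))) := by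
  have h1 := hl.sub ((tendsto_step_atTop.const_smul l).add
    ((tendsto_step_atTop.const_sub 1).const_smul m))
  have h2 := hm.sub ((tendsto_step_atBot.const_smul l).add
    ((tendsto_step_atBot.const_sub 1).const_smul m))
  rw [sub_self, smul_zero, add_zero, smul_eq_mul, mul_one, sub_self] at h1
  rw [smul_zero, zero_add, sub_zero, smul_eq_mul, mul_one, sub_self] at h2
  exact isC0_of_tendsto h1 h2

theorem isC0_step_mul_step_sub : IsC0 (step 1 * step 1 - step 1) := by
  have h1 := (tendsto_step_atTop.mul tendsto_step_atTop).sub tendsto_step_atTop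
  have h2 := (tendsto_step_atBot.mul tendsto_step_atBot).sub tendsto_step_atBot
  rw [mul_one, sub_self] at h1
  rw [mul_zero, sub_self] at h2
  exact isC0_of_tendsto h1 h2

theorem IsCpt.add {S T : BddOp} (hS : IsCpt S) (hT : IsCpt T) : IsCpt (S + T) :=
  IsCompactOperator.add hS hT

theorem IsCpt.sub {S T : BddOp} (hS : IsCpt S) (hT : IsCpt T) : IsCpt (S - T) :=
  IsCompactOperator.sub hS hT

theorem IsCpt.smul (c : ℂ) {T : BddOp} (hT : IsCpt T) : IsCpt (c • T) :=
  (compactOperator (RingHom.id ℂ) L2R L2R).smul_mem c hT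

theorem isCpt_zero : IsCpt 0 := isCompactOperator_zero

/-- `T ∈ J₀` has the symbol `f ∈ C₀(ℝ)` at the frequency `+∞` and `g ∈ C₀(ℝ)` at `-∞`. -/
structure HasSymbol (T : BddOp) (f g : ℝ →ᵇ ℂ) : Prop where
  left : IsC0 f
  right : IsC0 g
  lim_pos : HasLim 1 T (mulHom f)
  lim_neg : HasLim (-1) T (mulHom g)
  isCpt : IsCpt (T - ((mulHom f - mulHom g) * diffHom (step 1) + mulHom g))

theorem HasSymbol.add {S T : BddOp} {f g f' g' : ℝ →ᵇ ℂ} (hS : HasSymbol S f g)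
    (hT : HasSymbol T f' g') : HasSymbol (S + T) (f + f') (g + g') where
  left := hS.left.add hT.left
  right := hS.right.add hT.right
  lim_pos := by rw [map_add]; exact hS.lim_pos.add hT.lim_pos
  lim_neg := by rw [map_add]; exact hS.lim_neg.add hT.lim_neg
  isCpt := by
    have h := hS.isCpt.add hT.isCpt
    rw [map_add, map_add]
    convert! h using 1
    noncomm_ring

theorem HasSymbol.smul {T : BddOp} {f g : ℝ →ᵇ ℂ} (c : ℂ) (hT : HasSymbol T f g) :
    HasSymbol (c • T) (c • f) (c • g) where
  left := hT.left.smul c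
  right := hT.right.smul c
  lim_pos := by rw [map_smul]; exact hT.lim_pos.smul c
  lim_neg := by rw [map_smul]; exact hT.lim_neg.smul c
  isCpt := by
    have h := hT.isCpt.smul c
    rwa [smul_sub, smul_add, ← smul_mul_assoc, smul_sub, ← map_smul, ← map_smul] at h

/-- Purely algebraic: the difference is the combination h1 + h2 − h3 + h4 − h5. The first two terms
replace S and T by their models; the others move c to the right and replace c² by c. -/
theorem isCpt_mul_identity {f g h k c S T : BddOp} (h1 : IsCpt ((S - ((f - g) * c + g)) * T))
    (h2 : IsCpt (((f - g) * c + g) * (T - ((h - k) * c + k))))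
    (h3 : IsCpt ((f - g) * ((h - k) * c - c * (h - k)) * c))
    (h4 : IsCpt ((f - g) * ((h - k) * (c * c - c))))
    (h5 : IsCpt ((f - g) * (k * c - c * k))) :
    IsCpt (S * T - ((f * h - g * k) * c + g * k)) := by
  have h := (((h1.add h2).sub h3).add h4).sub h5
  convert! h using 1
  noncomm_ring

theorem HasSymbol.mul {S T : BddOp} {f g f' g' : ℝ →ᵇ ℂ} (hS : HasSymbol S f g)
    (hT : HasSymbol T f' g') : HasSymbol (S * T) (f * f') (g * g') where
  left := hS.left.mul_right _
  right := hS.right.mul_right _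
  lim_pos := by rw [map_mul]; exact hS.lim_pos.mul hT.lim_pos
  lim_neg := by rw [map_mul]; exact hS.lim_neg.mul hT.lim_neg
  isCpt := by
    have hd : IsC0 (f' - g') := by
      have := hT.left.add (hT.right.smul (-1))
      rwa [neg_one_smul, ← sub_eq_add_neg] at this
    rw [map_mul, map_mul]
    refine isCpt_mul_identity (isCompactOperator_mul_right hS.isCpt _)
      (isCompactOperator_mul_left hT.isCpt _) ?_ ?_ ?_
    · rw [← map_sub mulHom f' g']
      exact isCompactOperator_mul_right
        (isCompactOperator_mul_left (isCpt_commutator hd) _) _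
    · rw [← map_sub mulHom f' g', ← map_mul, ← map_sub diffHom]
      exact isCompactOperator_mul_left
        (isCompactOperator_mulHom_mul_diffHom hd isC0_step_mul_step_sub) _
    · exact isCompactOperator_mul_left (isCpt_commutator hT.right) _

theorem hasSymbol_zero : HasSymbol 0 0 0 where
  left := isC0_zero
  right := isC0_zero
  lim_pos := by simpa using hasLim_mulHom 1 0
  lim_neg := by simpa using hasLim_mulHom (-1) 0
  isCpt := by simpa using isCpt_zero

theorem smul_eq_mul_algebraMap (a : ℝ →ᵇ ℂ) (l : ℂ) : l • a = a * algebraMap ℂ _ l := by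
  rw [Algebra.smul_def, mul_comm]

/-- The symbol of `a(M)b(D)` and of `b(D)a(M)`. -/
theorem exists_hasSymbol {a b : ℝ →ᵇ ℂ} (ha : IsC0 a) (hb : b ∈ CS) :
    ∃ f g, HasSymbol (mulHom a * diffHom b) f g ∧ HasSymbol (diffHom b * mulHom a) f g := by
  obtain ⟨⟨l, hl⟩, ⟨m, hm⟩⟩ := hb
  have hb0 := isC0_sub_of_tendsto hl hm
  set c := diffHom (step 1)
  -- Here b = l·c + m·(1 − c) + b₀ with b₀ ∈ C₀, and b₀ contributes only compact operators.
  have hdiff : diffHom b = (l - m) • c + m • 1 +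
      diffHom (b - (l • step 1 + m • (1 - step 1))) := by
    rw [map_sub, map_add, map_smul, map_smul, map_sub, map_one, smul_sub, sub_smul]
    abel
  have hl' := hasLim_diffHom (tendsto_comp_add hl)
  have hm' := hasLim_diffHom (tendsto_comp_sub hm)
  have hsymb : (mulHom (l • a) - mulHom (m • a)) * c + mulHom (m • a) =
      (l - m) • (mulHom a * c) + m • mulHom a := by
    rw [map_smul, map_smul, ← sub_smul, smul_mul_assoc]
  refine ⟨l • a, m • a, ⟨ha.smul l, ha.smul m, ?_, ?_, ?_⟩, ⟨ha.smul l, ha.smul m, ?_, ?_, ?_⟩⟩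
  · rw [smul_eq_mul_algebraMap, map_mul]
    exact (hasLim_mulHom 1 a).mul hl'
  · rw [smul_eq_mul_algebraMap, map_mul]
    exact (hasLim_mulHom (-1) a).mul hm'
  · convert! isCompactOperator_mulHom_mul_diffHom ha hb0 using 1
    rw [hsymb, hdiff, mul_add, mul_add, mul_smul_comm, mul_smul_comm, mul_one]
    abel
  · rw [Algebra.smul_def, map_mul]
    exact hl'.mul (hasLim_mulHom 1 a)
  · rw [Algebra.smul_def, map_mul]
    exact hm'.mul (hasLim_mulHom (-1) a)
  · have h : IsCpt (_ - (l - m) • (mulHom a * c - c * mulHom a)) :=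
      (isCompactOperator_diffHom_mul_mulHom ha hb0).sub ((isCpt_commutator ha).smul (l - m))
    convert! h using 1
    rw [hsymb, hdiff, add_mul, add_mul, smul_mul_assoc, smul_mul_assoc, one_mul,
      smul_sub (l - m) (mulHom a * c)]
    abel

/-- The generators of the algebra `J₀`. -/
def genJ : Set BddOp := {T | ∃ a : C₀(ℝ, ℂ), ∃ b ∈ CS, T = mulOp a.toBCF * diffOp b}

theorem isC0_toBCF (a : C₀(ℝ, ℂ)) : IsC0 a.toBCF := a.zero_at_infty'

theorem exists_hasSymbol_of_mem_adjoin {T : BddOp} (hT : T ∈ NonUnitalStarAlgebra.adjoin ℂ genJ) :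
    ∃ f g, HasSymbol T f g := by
  -- Adjoints are needed only for generators, where they have the form b(D)a(M); this is why both
  -- orders were given a symbol.
  change T ∈ NonUnitalAlgebra.adjoin ℂ (genJ ∪ star genJ) at hT
  induction hT using NonUnitalAlgebra.adjoin_induction with
  | mem T hT =>
    rcases hT with ⟨a, b, hb, rfl⟩ | ⟨a, b, hb, h⟩
    · obtain ⟨f, g, h, -⟩ := exists_hasSymbol (isC0_toBCF a) hb
      rw [← mulHom_apply, ← diffHom_apply]
      exact ⟨f, g, h⟩
    · obtain ⟨f, g, -, h'⟩ := exists_hasSymbol (isC0_toBCF a).star (CS.star hb)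
      refine ⟨f, g, ?_⟩
      rwa [map_star, map_star, ← star_mul, mulHom_apply, diffHom_apply, ← h, star_star] at h'
  | add S T _ _ hS hT =>
    obtain ⟨f, g, h⟩ := hS
    obtain ⟨f', g', h'⟩ := hT
    exact ⟨_, _, h.add h'⟩
  | zero => exact ⟨0, 0, hasSymbol_zero⟩
  | mul S T _ _ hS hT =>
    obtain ⟨f, g, h⟩ := hS
    obtain ⟨f', g', h'⟩ := hT
    exact ⟨_, _, h.mul h'⟩
  | smul r T _ hT =>
    obtain ⟨f, g, h⟩ := hT
    exact ⟨_, _, h.smul r⟩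

theorem isCpt_of_mem {T : BddOp} (hJ : T ∈ algJ) (hE : T ∈ commIdeal) : IsCpt T := by
  obtain ⟨t, ht, hlim⟩ := mem_closure_iff_seq_limit.1
    (show T ∈ closure (NonUnitalStarAlgebra.adjoin ℂ genJ : Set BddOp) from hJ)
  choose f g h using fun n => exists_hasSymbol_of_mem_adjoin (ht n)
  have hnorm : Tendsto (fun n => ‖t n - T‖) atTop (𝓝 0) := tendsto_iff_norm_sub_tendsto_zero.1 hlim
  have hf : Tendsto (fun n => mulHom (f n)) atTop (𝓝 0) := by
    refine squeeze_zero_norm (fun n => ?_) hnorm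
    -- The limit of tₙ − T is fₙ(M), since T has limit 0, and passing to the limit does not increase
    -- norms.
    have h1 := ((h n).lim_pos.sub (hasLim_of_mem_commIdeal (.inl rfl) hE)).norm_le
    rwa [sub_zero] at h1
  have hg : Tendsto (fun n => mulHom (g n)) atTop (𝓝 0) := by
    refine squeeze_zero_norm (fun n => ?_) hnorm
    have h1 := ((h n).lim_neg.sub (hasLim_of_mem_commIdeal (.inr rfl) hE)).norm_le
    rwa [sub_zero] at h1
  have hT := hlim.sub (((hf.sub hg).mul_const (diffHom (step 1))).add hg)
  rw [sub_zero, zero_mul, add_zero, sub_zero] at hT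
  exact isClosed_compactOps.mem_of_tendsto hT (.of_forall fun n => (h n).isCpt)

/-! ### The compact operators belong to `J₀` and to `ℰ` -/

theorem mulHom_mul_diffHom_mem_algJ {a b : ℝ →ᵇ ℂ} (ha : IsC0 a) (hb : b ∈ CS) :
    mulHom a * diffHom b ∈ algJ := by
  have h : mulHom a * diffHom b ∈ genJ := ⟨⟨⟨a, a.continuous⟩, ha⟩, b, hb, by
    rw [diffHom_apply, mulHom_apply]
    congr 1⟩
  exact subset_closure (NonUnitalStarAlgebra.subset_adjoin ℂ genJ h)

theorem one_mem_CS : (1 : ℝ →ᵇ ℂ) ∈ CS := ⟨⟨1, tendsto_const_nhds⟩, ⟨1, tendsto_const_nhds⟩⟩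

theorem isC0_cut_mul_cut_sq (r : ℝ) : IsC0 ((cut 1 * cut r) ^ 2) := by
  have h : HasCompactSupport (cut 1 * cut r : ℝ →ᵇ ℂ) := (hasCompactSupport_cut r).mul_left
  rw [pow_two]
  exact (isC0_of_hasCompactSupport h).mul_right _

theorem mem_algJ_of_isCpt {T : BddOp} (hT : IsCpt T) : T ∈ algJ := by
  refine mem_of_isCpt (X := algJ.toSubmodule) isClosed_closure (fun f g hf hg r => ?_) hT
  have h1 := mulHom_mul_diffHom_mem_algJ (isC0_of_hasCompactSupport hf)
    (isC0_cut_mul_cut_sq r).mem_CS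
  have h2 := mulHom_mul_diffHom_mem_algJ (isC0_of_hasCompactSupport hg) one_mem_CS
  rw [map_one, mul_one] at h2
  exact algJ.mul_mem h1 h2

theorem mem_algA_of_mem_genA {T : BddOp} (hT : T ∈ genA) : T ∈ algA :=
  StarSubalgebra.le_topologicalClosure _ (StarAlgebra.subset_adjoin ℂ genA hT)

theorem mulHom_mem_algA {a : ℝ →ᵇ ℂ} (ha : a ∈ CS) : mulHom a ∈ algA :=
  mem_algA_of_mem_genA (.inl (.inl ⟨a, ha, rfl⟩))

theorem diffHom_mem_algA {b : ℝ →ᵇ ℂ} (hb : b ∈ CS) : diffHom b ∈ algA :=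
  mem_algA_of_mem_genA (.inr ⟨b, hb, diffHom_apply b⟩)

theorem expFun_mem_algA (j : ℤ) : mulHom (expFun j) ∈ algA :=
  mem_algA_of_mem_genA (.inl (.inr ⟨j, rfl⟩))

theorem commutator_mem_commIdeal {A B : BddOp} (hA : A ∈ algA) (hB : B ∈ algA) :
    A * B - B * A ∈ commIdeal :=
  ⟨⟨A, hA⟩ * ⟨B, hB⟩ - ⟨B, hB⟩ * ⟨A, hA⟩,
    subset_closure (TwoSidedIdeal.subset_span ⟨_, _, rfl⟩), rfl⟩

theorem commIdeal_mul_left {A T : BddOp} (hA : A ∈ algA) (hT : T ∈ commIdeal) :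
    A * T ∈ commIdeal := by
  obtain ⟨T, hT, rfl⟩ := hT
  refine ⟨⟨A, hA⟩ * T, map_mem_closure (f := fun T : algA => ⟨A, hA⟩ * T)
    (continuous_const_mul _) hT fun B hB => ?_, rfl⟩
  exact TwoSidedIdeal.mul_mem_left _ _ _ hB

theorem commIdeal_mul_right {A T : BddOp} (hA : A ∈ algA) (hT : T ∈ commIdeal) :
    T * A ∈ commIdeal := by
  obtain ⟨T, hT, rfl⟩ := hT
  refine ⟨T * ⟨A, hA⟩, map_mem_closure (f := fun T : algA => T * ⟨A, hA⟩)
    (continuous_mul_const _) hT fun B hB => ?_, rfl⟩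
  exact TwoSidedIdeal.mul_mem_right _ _ _ hB

/-- The commutator ideal as a subspace of the bounded operators. -/
def commSubmodule : Submodule ℂ BddOp where
  carrier := commIdeal
  add_mem' := by
    rintro _ _ ⟨S, hS, rfl⟩ ⟨T, hT, rfl⟩
    exact ⟨S + T, map_mem_closure₂ continuous_add hS hT fun A hA B hB =>
      TwoSidedIdeal.add_mem _ hA hB, rfl⟩
  zero_mem' := ⟨0, subset_closure (TwoSidedIdeal.zero_mem _), rfl⟩
  smul_mem' c T hT := by
    rw [Algebra.smul_def]
    exact commIdeal_mul_left (algebraMap_mem algA c) hT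

/-- The closure is taken inside 𝒜, and 𝒜 is itself closed among the bounded operators. -/
theorem isClosed_commIdeal : IsClosed commIdeal :=
  (isClosed_closure (s := (StarAlgebra.adjoin ℂ genA :
    Set BddOp))).isClosedEmbedding_subtypeVal.isClosedMap _ isClosed_closure

/-- The shift by 1 equals the ramp length, so the difference is exactly a tent of height 1. -/
theorem shift_step_sub : shift 1 (step 1) - step 1 = -cut 1 := by
  ext x
  change step 1 (x - 1) - step 1 x = -cut 1 x
  rw [step_apply, step_apply, cut_apply, ← Complex.ofReal_sub, ← Complex.ofReal_neg]
  congr 1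
  rw [div_one, div_one, sub_add_cancel]
  rcases abs_cases x with ⟨h, h'⟩ | ⟨h, h'⟩ <;> rw [h] <;>
    rcases max_cases 0 (min 1 x) with ⟨h1, h2⟩ | ⟨h1, h2⟩ <;> rw [h1] <;> grind

theorem diffHom_cut_mem_commIdeal : diffHom (cut 1) ∈ commIdeal := by
  have h1 := commutator_mem_commIdeal (expFun_mem_algA 1) (diffHom_mem_algA step_mem_CS)
  have h2 := commIdeal_mul_right (expFun_mem_algA (-1)) h1
  have h3 := commSubmodule.neg_mem h2
  have hexp : mulHom (expFun 1) * mulHom (expFun (-1)) = 1 := by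
    rw [expFun_eq, expFun_eq, ← map_mul, ← expR_add]
    simp [expR_zero]
  have h4 : mulHom (expFun 1) * diffHom (step 1) =
      diffHom (shift 1 (step 1)) * mulHom (expFun 1) := by
    have := mulHom_expR_mul_diffHom 1 (step 1)
    rwa [show expR 1 = expFun 1 by rw [expFun_eq]; simp] at this
  rwa [h4, ← sub_mul, ← map_sub, shift_step_sub, mul_assoc, hexp, mul_one, map_neg, neg_neg] at h3

/-- The factor `cut 1` in the localizations is there for this purpose: it puts them in the ideal
generated by the tent function of D. -/
theorem mem_commIdeal_of_isCpt {T : BddOp} (hT : IsCpt T) : T ∈ commIdeal := by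
  refine mem_of_isCpt (X := commSubmodule) isClosed_commIdeal (fun f g hf hg r => ?_) hT
  have hr : (cut 1 * cut r) ^ 2 = cut 1 * (cut r * (cut 1 * cut r)) := by ring
  have hc : cut r * (cut 1 * cut r) ∈ CS :=
    ((isC0_of_hasCompactSupport (hasCompactSupport_cut r)).mul_right _).mem_CS
  rw [hr, map_mul]
  exact commIdeal_mul_right (mulHom_mem_algA (isC0_of_hasCompactSupport hg).mem_CS)
    (commIdeal_mul_left (mulHom_mem_algA (isC0_of_hasCompactSupport hf).mem_CS)
      (commIdeal_mul_right (diffHom_mem_algA hc) diffHom_cut_mem_commIdeal))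

end SemiPeriodic
end

theorem mainTheorem10 :
    (SemiPeriodic.algJ : Set SemiPeriodic.BddOp) ∩ SemiPeriodic.commIdeal =
      SemiPeriodic.compactOps := by
  ext T
  exact ⟨fun h => SemiPeriodic.isCpt_of_mem h.1 h.2, fun h =>
    ⟨SemiPeriodic.mem_algJ_of_isCpt h, SemiPeriodic.mem_commIdeal_of_isCpt h⟩⟩
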